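/- A virtual knot is given by a signed Gauss diagram (an oriented circle with signed arrows pointing from the overpass to the underpass of each classical crossing), up to the Reidemeister moves on Gauss diagrams. For a diagram $D$ with writhe $w(D)$ (the sum of the signs of its crossings), let $f_D(A)=(-A^3)^{-w(D)}\langle D\rangle\in\mathbb{Z}[A,A^{-1}]$ be the Jones–Kauffman polynomial, where $\langle D\rangle=\sum_{s}A^{a(s)-b(s)}(-A^2-A^{-2})^{|s|-1}$, the sum runs over all Kauffman states $s$, $a(s)$ and $b(s)$ are the numbers of $A$- and $B$-smoothings in $s$, and $|s|$ is the number of closed curves of $s$. For $n\ge 0$ let $v_n(D)\in\mathbb{Q}$ be the $n$-th Birman coefficient, i.e. the coefficient of $x^n$ in the power series expansion of $f_D(e^x)$. Extend an invariant $v$ of virtual knots to diagrams with vertices (singular crossings) by $v(\text{vertex})=v(\text{positive crossing})-v(\text{negative crossing})$, and to diagrams with semivirtual crossings by $v(\text{semivirtual})=v(\text{real crossing})-v(\text{virtual crossing})$. The invariant $v$ is of Kauffman finite type $\le n$ if it vanishes on all diagrams with more than $n$ vertices, and of Goussarov–Polyak–Viro (GPV) finite type $\le m$ if it vanishes on all diagrams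 with more than $m$ semivirtual crossings. The virtualization move reverses one arrow of a Gauss diagram and keeps its sign. **Corollary (Kauffman, Chrisman).** For every $n\ge 0$, $v_n$ is a well-defined invariant of virtual knots, it is of Kauffman finite type $\le n$, and it is invariant under the virtualization move. For every $n\ge 2$, $v_n$ is not of GPV finite type $\le m$ for any $m\ge 0$. -/

import Mathlib

/-! ### Gauss diagrams -/

/-- An endpoint of an arrow of a signed Gauss diagram: the label of the arrow (a classical crossing),
whether the endpoint is the tail (overpass, `isOver = true`) or the head (underpass,
`isOver = false`), and the sign of the crossing. -/
@[ext]
structure GaussLetter where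
  crossing : ℕ
  isOver : Bool
  sign : ℤˣ
deriving DecidableEq

/-- A Gauss diagram on an oriented circle, given by the word of arrow endpoints met when traversing
the circle once from a base point. Each label that occurs in the word occurs exactly once as an
overpass and exactly once as an underpass, with the same sign. The choice of base point and of
labels is forgotten by the moves `GaussMove.rotate` and `GaussMove.relabel` below. -/
@[ext]
structure GaussDiagram where
  word : List GaussLetter
  nodup : (word.map fun l => (l.crossing, l.isOver)).Nodup
  paired : ∀ l ∈ word, GaussLetter.mk l.crossing (!l.isOver) l.sign ∈ word

namespace GaussDiagram

/-- The set of (labels of) classical crossings, i.e. of arrows. -/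
def crossings (D : GaussDiagram) : Finset ℕ := (D.word.map GaussLetter.crossing).toFinset

/-- The crossings of sign `+1`. -/
def positiveCrossings (D : GaussDiagram) : Finset ℕ :=
  ((D.word.filter fun l => l.sign = 1).map GaussLetter.crossing).toFinset

/-- Delete the arrows whose label is in `T` (make these crossings virtual). -/
def delete (D : GaussDiagram) (T : Finset ℕ) : GaussDiagram where
  word := D.word.filter fun l => l.crossing ∉ T
  nodup := D.nodup.sublist (List.filter_sublist.map _)
  paired := by
    intro l hl
    simp only [List.mem_filter, decide_eq_true_eq] at hl ⊢
    exact ⟨D.paired l hl.1, hl.2⟩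

/-- Reverse the arrows whose label is in `T` and multiply their signs by `e`. -/
def reverse (e : ℤˣ) (D : GaussDiagram) (T : Finset ℕ) : GaussDiagram where
  word := D.word.map fun l =>
    if l.crossing ∈ T then ⟨l.crossing, !l.isOver, e * l.sign⟩ else l
  nodup := by
    have h := D.nodup
    rw [List.map_map]
    have hf : ((fun l : GaussLetter => (l.crossing, l.isOver)) ∘ fun l : GaussLetter =>
        if l.crossing ∈ T then (⟨l.crossing, !l.isOver, e * l.sign⟩ : GaussLetter) else l)
        = (fun q : ℕ × Bool => if q.1 ∈ T then (q.1, !q.2) else q) ∘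
          fun l : GaussLetter => (l.crossing, l.isOver) := by
      funext l
      by_cases hl : l.crossing ∈ T <;> simp [hl]
    rw [hf, ← List.map_map]
    refine h.map ?_
    rintro ⟨a, b⟩ ⟨c, d⟩ h
    by_cases ha : a ∈ T <;> by_cases hc : c ∈ T <;> simp [ha, hc] at h <;> aesop
  paired := by
    intro l hl
    rw [List.mem_map] at hl ⊢
    obtain ⟨k, hk, rfl⟩ := hl
    refine ⟨_, D.paired k hk, ?_⟩
    by_cases h : k.crossing ∈ T <;> simp [h]

/-- Change the crossings in `T` (exchange overpass and underpass in the plane): the arrow is reversed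
and its sign changes. -/
def switch (D : GaussDiagram) (T : Finset ℕ) : GaussDiagram := D.reverse (-1) T

/-- The virtualization move at the crossing `c`: the arrow is reversed and its sign is kept. -/
def virtualize (D : GaussDiagram) (c : ℕ) : GaussDiagram := D.reverse 1 {c}

end GaussDiagram

/-! ### Virtual knots -/

/-- Two letters in the given order if `e = 1`, in the opposite order if `e = -1`. -/
def orderedPair (e : ℤˣ) (x y : GaussLetter) : List GaussLetter :=
  if e = 1 then [x, y] else [y, x]

/-- The generating moves of virtual isotopy on Gauss words: change of base point, change of labels,
and the three Reidemeister moves, with all signs and all orientations of the strands. The virtual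
moves (detours) do not change the Gauss diagram.

In the third move the crossings are `x` (top strand over middle strand, sign `a`), `y` (top over
bottom, sign `b`) and `z` (middle over bottom, sign `c`); every strand meets its two crossings
consecutively and the move exchanges them on each strand. For a triangle in the plane with these
signs, the orders are those of the left hand side or those of the right hand side. The two
constructors correspond to the two cyclic orders in which the knot runs through the strands. -/
inductive GaussMove : List GaussLetter → List GaussLetter → Prop
  | rotate (u v : List GaussLetter) : GaussMove (u ++ v) (v ++ u)
  | relabel (σ : Equiv.Perm ℕ) (w : List GaussLetter) :
      GaussMove w (w.map fun l => ⟨σ l.crossing, l.isOver, l.sign⟩)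
  | reidemeister1 (x : ℕ) (o : Bool) (e : ℤˣ) (w : List GaussLetter) :
      GaussMove ([⟨x, o, e⟩, ⟨x, !o, e⟩] ++ w) w
  | reidemeister2_parallel (x y : ℕ) (e : ℤˣ) (u v : List GaussLetter) :
      GaussMove ([⟨x, true, e⟩, ⟨y, true, -e⟩] ++ u ++ [⟨x, false, e⟩, ⟨y, false, -e⟩] ++ v)
        (u ++ v)
  | reidemeister2_antiparallel (x y : ℕ) (e : ℤˣ) (u v : List GaussLetter) :
      GaussMove ([⟨x, true, e⟩, ⟨y, true, -e⟩] ++ u ++ [⟨y, false, -e⟩, ⟨x, false, e⟩] ++ v)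
        (u ++ v)
  | reidemeister3_tmb (x y z : ℕ) (a b c : ℤˣ) (u v w : List GaussLetter) :
      GaussMove
        (orderedPair b ⟨x, true, a⟩ ⟨y, true, b⟩ ++ u ++
          orderedPair c ⟨x, false, a⟩ ⟨z, true, c⟩ ++ v ++
          orderedPair (a * b * c) ⟨y, false, b⟩ ⟨z, false, c⟩ ++ w)
        (orderedPair (-b) ⟨x, true, a⟩ ⟨y, true, b⟩ ++ u ++
          orderedPair (-c) ⟨x, false, a⟩ ⟨z, true, c⟩ ++ v ++
          orderedPair (-(a * b * c)) ⟨y, false, b⟩ ⟨z, false, c⟩ ++ w)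
  | reidemeister3_tbm (x y z : ℕ) (a b c : ℤˣ) (u v w : List GaussLetter) :
      GaussMove
        (orderedPair b ⟨x, true, a⟩ ⟨y, true, b⟩ ++ u ++
          orderedPair (a * b * c) ⟨y, false, b⟩ ⟨z, false, c⟩ ++ v ++
          orderedPair c ⟨x, false, a⟩ ⟨z, true, c⟩ ++ w)
        (orderedPair (-b) ⟨x, true, a⟩ ⟨y, true, b⟩ ++ u ++
          orderedPair (-(a * b * c)) ⟨y, false, b⟩ ⟨z, false, c⟩ ++ v ++
          orderedPair (-c) ⟨x, false, a⟩ ⟨z, true, c⟩ ++ w)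

/-- Virtual knots: Gauss diagrams modulo the equivalence relation generated by the moves. -/
def VirtualKnot : Type := Quot fun D D' : GaussDiagram => GaussMove D.word D'.word

/-- The virtual knot of a Gauss diagram. -/
def GaussDiagram.toKnot (D : GaussDiagram) : VirtualKnot := Quot.mk _ D

/-! ### The Jones–Kauffman polynomial and its Birman coefficients -/

namespace GaussDiagram

/-- The arcs of the diagram are numbered `0, …, N`, where `N` is the length of the word: arc `i` ends
and arc `i + 1` starts at the letter in position `i`; arcs `0` and `N` are the two parts of the arc
that holds the base point. At the crossing with overpass in position `i` and underpass in position
`j` this lists the four arcs counterclockwise, starting from the incoming lower arc. -/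
def arcsAround (D : GaussDiagram) (i j : Fin D.word.length) : Fin 4 → Fin (D.word.length + 1) :=
  if (D.word.get i).sign = 1 then ![j.castSucc, i.succ, j.succ, i.castSucc]
  else ![j.castSucc, i.castSucc, j.succ, i.succ]

/-- `D.IsCrossingAt i j`: the letters in positions `i` and `j` are the overpass and the underpass of
one crossing. -/
def IsCrossingAt (D : GaussDiagram) (i j : Fin D.word.length) : Prop :=
  (D.word.get i).isOver = true ∧ (D.word.get j).isOver = false ∧
    (D.word.get i).crossing = (D.word.get j).crossing

/-- Arcs joined in the Kauffman state in which the crossings in `S` are `A`-smoothed and all others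
are `B`-smoothed. The `A`-smoothing merges the two regions that the overcrossing line sweeps out
when it is turned counterclockwise, so it joins the first arc of `arcsAround` to the second and the
third to the fourth. -/
inductive StateJoined (D : GaussDiagram) (S : Finset ℕ) :
    Fin (D.word.length + 1) → Fin (D.word.length + 1) → Prop
  | basePoint : StateJoined D S 0 (Fin.last _)
  | smoothA₁ (i j : Fin D.word.length) (h : D.IsCrossingAt i j) (hS : (D.word.get i).crossing ∈ S) :
      StateJoined D S (D.arcsAround i j 0) (D.arcsAround i j 1)
  | smoothA₂ (i j : Fin D.word.length) (h : D.IsCrossingAt i j) (hS : (D.word.get i).crossing ∈ S) :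
      StateJoined D S (D.arcsAround i j 2) (D.arcsAround i j 3)
  | smoothB₁ (i j : Fin D.word.length) (h : D.IsCrossingAt i j) (hS : (D.word.get i).crossing ∉ S) :
      StateJoined D S (D.arcsAround i j 1) (D.arcsAround i j 2)
  | smoothB₂ (i j : Fin D.word.length) (h : D.IsCrossingAt i j) (hS : (D.word.get i).crossing ∉ S) :
      StateJoined D S (D.arcsAround i j 3) (D.arcsAround i j 0)

/-- The number of closed curves in a Kauffman state. -/
noncomputable def loops (D : GaussDiagram) (S : Finset ℕ) : ℕ := Nat.card (Quot (D.StateJoined S))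

/-- The writhe: the sum of the signs of the crossings. -/
def writhe (D : GaussDiagram) : ℤ :=
  ((D.word.filter fun l => l.isOver).map fun l => (l.sign : ℤ)).sum

open LaurentPolynomial in
/-- The Kauffman bracket, with the unknot normalized to `1`; the variable `A` is `T 1`. -/
noncomputable def bracket (D : GaussDiagram) : LaurentPolynomial ℤ :=
  ∑ S ∈ D.crossings.powerset,
    T ((S.card : ℤ) - ((D.crossings \ S).card : ℤ)) * (-T 2 - T (-2)) ^ (D.loops S - 1)

open LaurentPolynomial in
/-- The Jones–Kauffman polynomial `(-A ^ 3) ^ (-w) * ⟨D⟩`, where `w` is the writhe. -/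
noncomputable def jonesKauffman (D : GaussDiagram) : LaurentPolynomial ℤ :=
  C ((D.writhe.negOnePow : ℤˣ) : ℤ) * T (-3 * D.writhe) * D.bracket

end GaussDiagram

/-- The power series `e ^ x` as a unit. -/
noncomputable def expUnit : (PowerSeries ℚ)ˣ where
  val := PowerSeries.exp ℚ
  inv := PowerSeries.evalNegHom (PowerSeries.exp ℚ)
  val_inv := PowerSeries.exp_mul_exp_neg_eq_one
  inv_val := by rw [mul_comm]; exact PowerSeries.exp_mul_exp_neg_eq_one

/-- The coefficient of `x ^ n` in the power series obtained from the Jones–Kauffman polynomial by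
the substitution `A = e ^ x`. -/
noncomputable def GaussDiagram.birmanCoeff (n : ℕ) (D : GaussDiagram) : ℚ :=
  PowerSeries.coeff n
    (LaurentPolynomial.eval₂ (Int.castRingHom (PowerSeries ℚ)) expUnit D.jonesKauffman)

/-! ### Finite type invariants -/

section FiniteType

variable {G : Type*} [AddCommGroup G]

/-- The value of the extension of `v` on the diagram with singular crossings (rigid vertices) that is
obtained from `D` by replacing each of the positive crossings in `S` by a vertex. By
`v(vertex) = v(positive) - v(negative)` it is an alternating sum over the set `T` of the vertices
that are resolved negatively. -/
def kauffmanExtension (v : VirtualKnot → G) (D : GaussDiagram) (S : Finset ℕ) : G :=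
  ∑ T ∈ S.powerset, (-1 : ℤ) ^ T.card • v (D.switch T).toKnot

/-- `v` is of Kauffman finite type `≤ n`: it vanishes on all diagrams with more than `n` vertices. -/
def IsKauffmanFiniteType (n : ℕ) (v : VirtualKnot → G) : Prop :=
  ∀ (D : GaussDiagram) (S : Finset ℕ), S ⊆ D.positiveCrossings → n < S.card →
    kauffmanExtension v D S = 0

/-- The value of the extension of `v` on the diagram with semivirtual crossings that is obtained from
`D` by making the crossings in `S` semivirtual (the arrows in `S` dashed). By
`v(semivirtual) = v(real) - v(virtual)` it is an alternating sum over the set `T` of the crossings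
that become virtual. -/
def gpvExtension (v : VirtualKnot → G) (D : GaussDiagram) (S : Finset ℕ) : G :=
  ∑ T ∈ S.powerset, (-1 : ℤ) ^ T.card • v (D.delete T).toKnot

/-- `v` is of Goussarov–Polyak–Viro finite type `≤ m`: it vanishes on all diagrams with more than `m`
semivirtual crossings. -/
def IsGPVFiniteType (m : ℕ) (v : VirtualKnot → G) : Prop :=
  ∀ (D : GaussDiagram) (S : Finset ℕ), S ⊆ D.crossings → m < S.card → gpvExtension v D S = 0

end FiniteType

/-- `v` is invariant under the virtualization move. -/
def IsVirtualizationInvariant {G : Type*} (v : VirtualKnot → G) : Prop :=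
  ∀ (D : GaussDiagram), ∀ c ∈ D.crossings, v (D.virtualize c).toKnot = v D.toKnot

/-! Invariance. When `-A^2 - A^(-2)` equals a positive integer d, each closed curve of a Kauffman
state can be replaced by a sum over d colours. Then d times the value of the Jones–Kauffman
polynomial is a vertex model: the sum, over all labellings of the crossings by a smoothing and two
colours, of the trace of a product of matrices read along the Gauss word (`stateSum`,
`eval₂_jonesKauffman_mul_card`). Planarity plays no role, so virtual crossings need no treatment.
Reidemeister moves become local identities between matrices: the third is the Yang–Baxter equation
for the crossing tensor, the second says that crossings of opposite signs give inverse tensors, and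
the first is absorbed by the writhe factor. The identities hold at infinitely many complex A, hence
for Laurent polynomials (`LaurentPolynomial.ext_of_eval`).

Reversal of arrows. Colourings treat the two strands of a smoothed crossing symmetrically. Reversing
an arrow with its sign kept therefore changes no loop count, which gives virtualization invariance;
changing the sign as well exchanges the two smoothings (`loops_reverse`).

Kauffman type. After states are reindexed by this exchange, the alternating sum over switched
vertices factors, with one factor `A^(±1) - A^6 * A^(∓1)` per vertex. It vanishes at `A = 1`, so for
`A = e^x` more than n vertices give divisibility by `x^(n+1)`.

GPV type. For the twist of ℓ parallel positive arrows, δ times the polynomial, with `δ = -A^2 -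
A^(-2)`, is a combination of `(-A^(-2))^ℓ`, `(A^(-2))^ℓ` and `(A^(-6))^ℓ` with coefficients
independent of ℓ. Making k arrows semivirtual turns each `z^ℓ` into `(z - 1)^k`. The last two then
vanish to order k at `x = 0`, but `-A^(-2) - 1` tends to -2, and its coefficient `(δ - 1) * (δ + 2)`
vanishes only to order 2. A binomial combination of consecutive k raises the order of this term to
exactly n, so not all coefficients of `x^n` with k large can be zero. -/

set_option linter.unusedSectionVars false

/-! ### Sums over labellings of crossings -/

section SumOver

variable {ι R : Type*} [Fintype ι] [Inhabited ι] [AddCommMonoid R]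

/-- The sum of `F` over all labellings of the crossings in a list by elements of `ι`; the other
crossings have the default label. -/
def sumOver : List ℕ → ((ℕ → ι) → R) → R
  | [], F => F default
  | x :: xs, F => ∑ p, sumOver xs fun r => F (Function.update r x p)

theorem sumOver_cons (x : ℕ) (xs : List ℕ) (F : (ℕ → ι) → R) :
    sumOver (x :: xs) F = ∑ p, sumOver xs fun r => F (Function.update r x p) := rfl

theorem sumOver_sum {κ : Type*} (s : Finset κ) (xs : List ℕ) (F : κ → (ℕ → ι) → R) :
    sumOver xs (fun r => ∑ k ∈ s, F k r) = ∑ k ∈ s, sumOver xs (F k) := by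
  induction xs generalizing F with
  | nil => rfl
  | cons x xs ih =>
    simp only [sumOver_cons]
    rw [Finset.sum_comm]
    exact Finset.sum_congr rfl fun p _ => ih fun k r => F k (Function.update r x p)

theorem sumOver_perm {xs ys : List ℕ} (h : xs.Perm ys) (hn : xs.Nodup) (F : (ℕ → ι) → R) :
    sumOver xs F = sumOver ys F := by
  induction h generalizing F with
  | nil => rfl
  | cons x h ih => simp only [sumOver_cons, ih (List.nodup_cons.1 hn).2]
  | swap x y l =>
    have hxy : y ≠ x := by
      rintro rfl
      simp at hn
    simp only [sumOver_cons]
    rw [Finset.sum_comm]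
    simp only [Function.update_comm hxy]
  | trans h₁ _ ih₁ ih₂ => rw [ih₁ hn, ih₂ (h₁.nodup_iff.1 hn)]

/-- The function `F` depends only on the labels of the crossings in the list. -/
def LocalOn (xs : List ℕ) (F : (ℕ → ι) → R) : Prop :=
  ∀ r r' : ℕ → ι, (∀ x ∈ xs, r x = r' x) → F r = F r'

theorem LocalOn.update {x : ℕ} {xs : List ℕ} {F : (ℕ → ι) → R} (h : LocalOn (x :: xs) F) (p : ι) :
    LocalOn xs fun r => F (Function.update r x p) := by
  intro r r' hr
  refine h _ _ fun y hy => ?_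
  by_cases hyx : y = x
  · subst hyx; simp
  · simp only [Function.update_of_ne hyx]
    exact hr y ((List.mem_cons.1 hy).resolve_left hyx)

theorem sumOver_congr {xs : List ℕ} {F F' : (ℕ → ι) → R} (h : ∀ r, F r = F' r) :
    sumOver xs F = sumOver xs F' := by
  rw [funext h]

theorem sumOver_map_equiv {xs : List ℕ} (σ : Equiv.Perm ℕ) {F : (ℕ → ι) → R} :
    sumOver (xs.map σ) F = sumOver xs fun r => F fun x => r (σ.symm x) := by
  induction xs generalizing F with
  | nil => rfl
  | cons x xs ih =>
    rw [List.map_cons, sumOver_cons, sumOver_cons]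
    refine Finset.sum_congr rfl fun p _ => ?_
    rw [ih]
    refine sumOver_congr fun r => congrArg F (funext fun y => ?_)
    by_cases hy : y = σ x
    · subst hy; simp
    · rw [Function.update_of_ne hy, Function.update_of_ne]
      rintro rfl
      simp at hy

/-- Locality is needed because `e` also moves the default label of the crossings outside the list.
-/
theorem sumOver_relabel {xs : List ℕ} (hn : xs.Nodup) (e : ℕ → Equiv.Perm ι) {F : (ℕ → ι) → R}
    (hF : LocalOn xs F) : sumOver xs (fun r => F fun x => e x (r x)) = sumOver xs F := by
  induction xs generalizing F with
  | nil => exact hF _ _ (by simp)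
  | cons x xs ih =>
    obtain ⟨hx, hn⟩ := List.nodup_cons.1 hn
    rw [sumOver_cons, sumOver_cons]
    refine Eq.trans ?_ (Equiv.sum_comp (e x) _)
    refine Finset.sum_congr rfl fun p _ => ?_
    rw [← ih hn (hF.update _)]
    refine sumOver_congr fun r => congrArg F (funext fun y => ?_)
    by_cases hy : y = x
    · subst hy; simp
    · simp [Function.update_of_ne hy]

theorem sumOver_zero (xs : List ℕ) : sumOver xs (fun _ : ℕ → ι => (0 : R)) = 0 := by
  induction xs with
  | nil => rfl
  | cons x xs ih => simp [sumOver_cons, ih]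

/-- If `F` vanishes unless all labels are those given by `g`, the sum has one term. -/
theorem sumOver_eq_single {xs : List ℕ} (hn : xs.Nodup) (g : ℕ → ι) {F : (ℕ → ι) → R}
    (hF : LocalOn xs F) (h0 : ∀ r, ∀ x ∈ xs, r x ≠ g x → F r = 0) : sumOver xs F = F g := by
  induction xs generalizing F with
  | nil => exact hF _ _ (by simp)
  | cons x xs ih =>
    obtain ⟨hx, hn⟩ := List.nodup_cons.1 hn
    rw [sumOver_cons, Finset.sum_eq_single (g x)]
    · rw [ih hn (hF.update _)]
      · simp
      · intro r y hy hne
        refine h0 _ y (List.mem_cons_of_mem _ hy) ?_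
        rwa [Function.update_of_ne (by rintro rfl; exact hx hy)]
    · intro p _ hp
      rw [← sumOver_zero (ι := ι) xs]
      exact sumOver_congr fun r => h0 _ x (by simp) (by simpa using hp)
    · simp

theorem mul_sumOver {R : Type*} [NonUnitalNonAssocSemiring R] (a : R) (xs : List ℕ)
    (F : (ℕ → ι) → R) : a * sumOver xs F = sumOver xs fun r => a * F r := by
  induction xs generalizing F with
  | nil => rfl
  | cons x xs ih => simp only [sumOver_cons, Finset.mul_sum, ih]

/-- A sum over labels with a Boolean component as a sum over sets of crossings. -/
theorem sumOver_prod_bool {xs : List ℕ} (hn : xs.Nodup) (F : (ℕ → Bool × ι) → R) :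
    sumOver xs F = ∑ S ∈ xs.toFinset.powerset,
      sumOver xs fun r : ℕ → ι => F fun x => (decide (x ∈ S), r x) := by
  induction xs generalizing F with
  | nil => simp [sumOver]; rfl
  | cons x xs ih =>
    obtain ⟨hx, hn⟩ := List.nodup_cons.1 hn
    have hx' : x ∉ xs.toFinset := by simpa using hx
    rw [List.toFinset_cons, Finset.sum_powerset_insert hx', sumOver_cons, Fintype.sum_prod_type,
      Fintype.sum_bool, add_comm]
    congr 1
    · simp only [ih hn, sumOver_cons]
      rw [Finset.sum_comm]
      refine Finset.sum_congr rfl fun S hS => Finset.sum_congr rfl fun p _ => sumOver_congr fun r => ?_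
      congr 1
      funext y
      by_cases hy : y = x
      · subst hy
        simpa using fun h => hx' (Finset.mem_powerset.1 hS h)
      · simp [Function.update_of_ne hy]
    · simp only [ih hn, sumOver_cons]
      rw [Finset.sum_comm]
      refine Finset.sum_congr rfl fun S hS => Finset.sum_congr rfl fun p _ => sumOver_congr fun r => ?_
      congr 1
      funext y
      by_cases hy : y = x
      · subst hy; simp
      · simp [hy]

end SumOver

/-! ### The crossing tensor -/

section CrossingKernel

variable {K R : Type*} [Fintype K] [DecidableEq K] [CommRing R]

/-- The weight of a crossing when the first strand has colours `i`, `j` before and after the crossing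
and the second strand has colours `k`, `l`. -/
def crossingKernel (s t : R) (i j k l : K) : R :=
  (if i = l then if j = k then s else 0 else 0) + (if i = k then if j = l then t else 0 else 0)

/-- The weight `s` belongs to the smoothing that respects the orientations of the strands and `t` to
the other one. Reversing one strand exchanges the two. -/
theorem crossingKernel_swap (s t : R) (i j k l : K) :
    crossingKernel s t j i k l = crossingKernel t s i j k l := by
  simp only [crossingKernel]
  rw [add_comm]
  congr 1 <;> split_ifs <;> simp_all

theorem crossingKernel_swap_right (s t : R) (i j k l : K) :
    crossingKernel s t i j l k = crossingKernel t s i j k l := by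
  simp only [crossingKernel]
  rw [add_comm]

theorem ite_eq_one_apply_mul (a b : K) (x : R) :
    (if a = b then x else 0) = (1 : Matrix K K R) a b * x := by
  simp [Matrix.one_apply]

theorem one_apply_comm (a b : K) : (1 : Matrix K K R) a b = (1 : Matrix K K R) b a := by
  simp [Matrix.one_apply, eq_comm]

/-- The Yang–Baxter equation for the crossing tensor. -/
theorem crossingKernel_yangBaxter {s t : R} (hst : s * t = 1)
    (hd : (Fintype.card K : R) = -s ^ 2 - t ^ 2) (i₁ j₁ i₂ j₂ i₃ j₃ : K) :
    ∑ m₁, ∑ m₂, ∑ m₃, crossingKernel s t i₁ m₁ i₂ m₂ * crossingKernel s t m₁ j₁ i₃ m₃ *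
        crossingKernel s t m₂ j₂ m₃ j₃ =
      ∑ m₁, ∑ m₂, ∑ m₃, crossingKernel s t m₁ j₁ m₂ j₂ * crossingKernel s t i₁ m₁ m₃ j₃ *
        crossingKernel s t i₂ m₂ i₃ m₃ := by
  simp only [crossingKernel, add_mul, mul_add, Finset.sum_add_distrib, ite_mul, mul_ite, zero_mul,
    mul_zero, ite_add_zero, Finset.sum_ite_irrel, Finset.sum_ite_eq, Finset.sum_ite_eq',
    Finset.mem_univ, if_true, Finset.sum_const_zero, Finset.sum_const, Finset.card_univ,
    nsmul_eq_mul, hd]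
  simp only [ite_eq_one_apply_mul]
  rw [one_apply_comm i₃ j₁, one_apply_comm i₃ i₂, one_apply_comm j₃ j₂, one_apply_comm i₂ j₂,
    one_apply_comm j₁ i₁, one_apply_comm j₃ i₁, one_apply_comm i₃ j₃]
  -- Each side contains one pairing that also arises with a closed curve. Its total coefficient is
  -- `s^2 t + t^3 + s t^2 d = (s^2 t + t^3)(1 - s t)`, which vanishes; all other pairings match.
  linear_combination ((1 : Matrix K K R) i₂ i₃ * (1 : Matrix K K R) i₁ j₃ *
    (1 : Matrix K K R) j₁ j₂ - (1 : Matrix K K R) i₁ i₂ * (1 : Matrix K K R) j₂ j₃ *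
    (1 : Matrix K K R) j₁ i₃) * (s ^ 2 * t + t ^ 3) * hst

/-- The two strands pass straight through with coefficient `s t = 1`. The turn-back pairing gets
`s^2 + t^2` from mixed smoothings and `s t d` from the closed curve, and these cancel. -/
theorem crossingKernel_mul_inverse {s t : R} (hst : s * t = 1)
    (hd : (Fintype.card K : R) = -s ^ 2 - t ^ 2) (i₁ j₁ i₂ j₂ : K) :
    ∑ m₁, ∑ m₂, crossingKernel s t i₁ m₁ i₂ m₂ * crossingKernel t s m₁ j₁ m₂ j₂ =
      (1 : Matrix K K R) i₁ j₁ * (1 : Matrix K K R) i₂ j₂ := by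
  simp only [crossingKernel, add_mul, mul_add, Finset.sum_add_distrib, ite_mul, mul_ite, zero_mul,
    mul_zero, ite_add_zero, Finset.sum_ite_irrel, Finset.sum_ite_eq, Finset.sum_ite_eq',
    Finset.mem_univ, if_true, Finset.sum_const_zero, Finset.sum_const, Finset.card_univ,
    nsmul_eq_mul, hd]
  simp only [ite_eq_one_apply_mul]
  rw [one_apply_comm j₂ i₂, one_apply_comm j₂ j₁]
  linear_combination ((1 : Matrix K K R) i₁ j₁ * (1 : Matrix K K R) i₂ j₂ -
    (1 : Matrix K K R) i₁ i₂ * (1 : Matrix K K R) j₁ j₂ * (s ^ 2 + t ^ 2)) * hst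

end CrossingKernel

/-! ### Matrices of strands -/

section LetterMatrix

variable {K R : Type*} [Fintype K] [DecidableEq K] [CommRing R]

/-- The normalization `(-A ^ 3) ^ (-e)` of a crossing of sign `e`. -/
def writheFactor (A : Rˣ) (e : ℤˣ) : Rˣ := (-A ^ 3) ^ (-(e : ℤ))

theorem writheFactor_mul_neg (A : Rˣ) (e : ℤˣ) :
    (writheFactor A e : R) * writheFactor A (-e) = 1 := by
  rw [← Units.val_mul, writheFactor, writheFactor, ← zpow_add]
  simp

/-- The matrix of a strand that passes a crossing of sign `e`. The crossing is `A`-smoothed if the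
first component of `q` is `true`, and the two curves of the smoothing have the colours in the second
component. The weight is attached to the overpass. -/
def strandMatrix (A : Rˣ) (e : ℤˣ) (o : Bool) (q : Bool × K × K) : Matrix K K R :=
  if o then Matrix.single q.2.1 q.2.2 ((writheFactor A e * if q.1 then A else A⁻¹ : Rˣ) : R)
  else if q.1 = true ↔ e = 1 then Matrix.single q.2.2 q.2.1 1 else Matrix.single q.2.1 q.2.2 1

/-- Transposition if `b = -1`. -/
def signTranspose (b : ℤˣ) (P : Matrix K K R) : Matrix K K R := if b = 1 then P else P.transpose

theorem sum_single_mul_single_swap (x y : R) (i j k l : K) :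
    ∑ p : K × K, Matrix.single p.1 p.2 x i j * Matrix.single p.2 p.1 y k l =
      if i = l then if j = k then x * y else 0 else 0 := by
  rw [Finset.sum_eq_single (i, j)]
  · simp only [Matrix.single_apply, and_self, if_true, ite_and, mul_ite, mul_zero]
    split_ifs <;> rfl
  · rintro ⟨a, b⟩ - h
    rw [Matrix.single_apply_of_ne, zero_mul]
    simpa using h
  · simp

theorem sum_single_mul_single (x y : R) (i j k l : K) :
    ∑ p : K × K, Matrix.single p.1 p.2 x i j * Matrix.single p.1 p.2 y k l =
      if i = k then if j = l then x * y else 0 else 0 := by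
  rw [← sum_single_mul_single_swap x y i j l k]
  refine Finset.sum_congr rfl fun p _ => ?_
  congr 1
  rw [← Matrix.transpose_single, Matrix.transpose_apply]

/-- Passage from labels to tensors: summing out the label of one crossing leaves its kernel. Each
reversal of a strand flips the exponent of `A`, since it decides which smoothing is the oriented
one. -/
theorem sum_strandMatrix (A : Rˣ) (e b c : ℤˣ) (i j k l : K) :
    ∑ q : Bool × K × K, signTranspose b (strandMatrix A e true q) i j *
        signTranspose c (strandMatrix A e false q) k l =
      writheFactor A e * crossingKernel ((A ^ ((e * b * c : ℤˣ) : ℤ) : Rˣ) : R)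
        ((A ^ (-((e * b * c : ℤˣ) : ℤ)) : Rˣ) : R) i j k l := by
  have h : ∀ i j k l : K, ∑ q : Bool × K × K, strandMatrix A e true q i j * strandMatrix A e false q k l =
      writheFactor A e * crossingKernel ((A ^ (e : ℤ) : Rˣ) : R) ((A ^ (-(e : ℤ)) : Rˣ) : R)
        i j k l := by
    intro i j k l
    rw [Fintype.sum_prod_type, Fintype.sum_bool]
    rcases Int.units_eq_one_or e with rfl | rfl <;>
    simp [strandMatrix, sum_single_mul_single_swap, sum_single_mul_single, crossingKernel, mul_add,
      add_comm]
  have hb : ∀ (b : ℤˣ) (P : Matrix K K R) (i j : K),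
      signTranspose b P i j = if b = 1 then P i j else P j i := by
    intro b P i j
    unfold signTranspose
    split_ifs <;> rfl
  simp only [hb]
  rcases Int.units_eq_one_or b with rfl | rfl <;> rcases Int.units_eq_one_or c with rfl | rfl <;>
  simp [h, crossingKernel_swap _ _ i j, crossingKernel_swap_right _ _ i j k l]

/-- The product of the matrices of two consecutive letters in the order of `orderedPair`. -/
def orderedProduct (b : ℤˣ) (P Q : Matrix K K R) : Matrix K K R := if b = 1 then P * Q else Q * P

theorem orderedProduct_neg (b : ℤˣ) (P Q : Matrix K K R) :
    orderedProduct (-b) P Q = orderedProduct b Q P := by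
  rcases Int.units_eq_one_or b with rfl | rfl <;> simp [orderedProduct]

/-- Transposition reverses products, so a strand met in the opposite order is a transposed strand
met in the standard order. This reduces all orientations in the moves to one. -/
theorem orderedProduct_eq (b : ℤˣ) (P Q : Matrix K K R) :
    orderedProduct b P Q = signTranspose b (signTranspose b P * signTranspose b Q) := by
  rcases Int.units_eq_one_or b with rfl | rfl <;>
  simp [orderedProduct, signTranspose, Matrix.transpose_mul]

theorem signTranspose_apply (b : ℤˣ) (P : Matrix K K R) (i j : K) :
    signTranspose b P i j = if b = 1 then P i j else P j i := by
  unfold signTranspose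
  split_ifs <;> rfl

theorem sum_mul_sum_mul_sum {α β γ : Type*} [Fintype α] [Fintype β] [Fintype γ] (f : α → R)
    (g : β → R) (h : γ → R) : (∑ x, f x) * (∑ x, g x) * (∑ x, h x) =
      ∑ x : α × β × γ, f x.1 * g x.2.1 * h x.2.2 := by
  rw [Finset.sum_mul_sum, Fintype.sum_prod_type, Finset.sum_mul]
  refine Finset.sum_congr rfl fun x _ => ?_
  rw [Finset.sum_mul_sum, Fintype.sum_prod_type]

/-- In the third move each crossing lies on two of the three strands. Exchanging the sums over
labels with those over the inner arcs lets each label be summed by itself. -/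
theorem sum_mul_mul_comm {α β γ : Type*} [Fintype α] [Fintype β] [Fintype γ]
    (f₁ f₂ : α → K → R) (g₁ g₂ : β → K → R) (h₁ h₂ : γ → K → R) :
    ∑ p, ∑ q, ∑ r, (∑ m, f₁ p m * g₁ q m) * (∑ m, f₂ p m * h₁ r m) * (∑ m, g₂ q m * h₂ r m) =
      ∑ m₁, ∑ m₂, ∑ m₃, (∑ p, f₁ p m₁ * f₂ p m₂) * (∑ q, g₁ q m₁ * g₂ q m₃) *
        (∑ r, h₁ r m₂ * h₂ r m₃) := by
  simp only [sum_mul_sum_mul_sum]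
  have h1 : ∀ F : α → β → γ → R, ∑ p, ∑ q, ∑ r, F p q r = ∑ x : α × β × γ, F x.1 x.2.1 x.2.2 := by
    intro F; simp only [Fintype.sum_prod_type]
  have h2 : ∀ F : K → K → K → R, ∑ p, ∑ q, ∑ r, F p q r = ∑ x : K × K × K, F x.1 x.2.1 x.2.2 := by
    intro F; simp only [Fintype.sum_prod_type]
  rw [h1, h2, Finset.sum_comm]
  exact Finset.sum_congr rfl fun _ _ => Finset.sum_congr rfl fun _ _ => by ring

/-- The third Reidemeister move on matrix entries. -/
theorem sum_orderedProduct_reidemeister3 (A : Rˣ)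
    (hd : (Fintype.card K : R) = -(A : R) ^ 2 - ((A⁻¹ : Rˣ) : R) ^ 2) (a b c : ℤˣ)
    (i₁ j₁ i₂ j₂ i₃ j₃ : K) :
    ∑ p, ∑ q, ∑ r, orderedProduct b (strandMatrix A a true p) (strandMatrix A b true q) i₁ j₁ *
        orderedProduct c (strandMatrix A a false p) (strandMatrix A c true r) i₂ j₂ *
        orderedProduct (a * b * c) (strandMatrix A b false q) (strandMatrix A c false r) i₃ j₃ =
      ∑ p, ∑ q, ∑ r,
        orderedProduct (-b) (strandMatrix A a true p) (strandMatrix A b true q) i₁ j₁ *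
        orderedProduct (-c) (strandMatrix A a false p) (strandMatrix A c true r) i₂ j₂ *
        orderedProduct (-(a * b * c)) (strandMatrix A b false q) (strandMatrix A c false r)
          i₃ j₃ := by
  have key : ∀ i₁ j₁ i₂ j₂ i₃ j₃ : K, ∑ p : Bool × K × K, ∑ q : Bool × K × K, ∑ r : Bool × K × K,
        (signTranspose b (strandMatrix (R := R) A a true p) *
          signTranspose b (strandMatrix A b true q))
          i₁ j₁ *
        (signTranspose c (strandMatrix A a false p) * signTranspose c (strandMatrix A c true r))
          i₂ j₂ *
        (signTranspose (a * b * c) (strandMatrix A b false q) *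
          signTranspose (a * b * c) (strandMatrix A c false r)) i₃ j₃ =
      ∑ p : Bool × K × K, ∑ q : Bool × K × K, ∑ r : Bool × K × K,
        (signTranspose b (strandMatrix A b true q) * signTranspose b (strandMatrix A a true p))
          i₁ j₁ *
        (signTranspose c (strandMatrix A c true r) * signTranspose c (strandMatrix A a false p))
          i₂ j₂ *
        (signTranspose (a * b * c) (strandMatrix A c false r) *
          signTranspose (a * b * c) (strandMatrix A b false q)) i₃ j₃ := by
    intro i₁ j₁ i₂ j₂ i₃ j₃
    -- With the strands transposed according to `b`, `c` and `a * b * c`, the exponents at the three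
    -- crossings are all `a * b * c`. Hence a single Yang–Baxter equation serves all choices of
    -- signs.
    have h1 : b * b * (a * b * c) = a * b * c := by simp
    have h2 : c * c * (a * b * c) = a * b * c := by simp
    simp only [Matrix.mul_apply]
    rw [sum_mul_mul_comm]
    simp only [mul_comm (signTranspose b (strandMatrix A b true _) _ _),
      mul_comm (signTranspose c (strandMatrix A c true _) _ _) (signTranspose c _ _ _),
      mul_comm (signTranspose (a * b * c) (strandMatrix A c false _) _ _)]
    rw [sum_mul_mul_comm]
    simp only [mul_comm (signTranspose (a * b * c) (strandMatrix A b false _) _ _)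
      (signTranspose b _ _ _), sum_strandMatrix, h1, h2]
    have hyb := crossingKernel_yangBaxter (R := R) (K := K)
      (s := ((A ^ ((a * b * c : ℤˣ) : ℤ) : Rˣ) : R))
      (t := ((A ^ (-((a * b * c : ℤˣ) : ℤ)) : Rˣ) : R)) (by rw [← Units.val_mul, ← zpow_add]; simp)
      (by
        rw [hd]
        rcases Int.units_eq_one_or (a * b * c) with h | h <;> rw [h] <;> simp
        ring) i₁ j₁ i₂ j₂ i₃ j₃
    have := congrArg (fun z => (writheFactor A a : R) * writheFactor A b * writheFactor A c * z) hyb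
    simp only [Finset.mul_sum] at this
    have hr : ∀ x y z : R, writheFactor A a * x * (writheFactor A b * y) * (writheFactor A c * z) =
        writheFactor A a * writheFactor A b * writheFactor A c * (x * y * z) := by
      intro x y z
      ring
    simpa only [hr] using this
  simp only [orderedProduct_neg]
  simp only [orderedProduct_eq, signTranspose_apply _ (_ * _)]
  split_ifs <;> apply key

theorem sum_mul_comm {α β : Type*} [Fintype α] [Fintype β] (f₁ f₂ : α → K → R)
    (g₁ g₂ : β → K → R) :
    ∑ p, ∑ q, (∑ m, f₁ p m * g₁ q m) * (∑ m, f₂ p m * g₂ q m) =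
      ∑ m₁, ∑ m₂, (∑ p, f₁ p m₁ * f₂ p m₂) * (∑ q, g₁ q m₁ * g₂ q m₂) := by
  have h1 : ∀ F : α → β → R, ∑ p, ∑ q, F p q = ∑ x : α × β, F x.1 x.2 := by
    intro F; rw [Fintype.sum_prod_type]
  have h2 : ∀ F : K → K → R, ∑ p, ∑ q, F p q = ∑ x : K × K, F x.1 x.2 := by
    intro F; rw [Fintype.sum_prod_type]
  simp only [Finset.sum_mul_sum, h1, h2]
  rw [Finset.sum_comm]
  exact Finset.sum_congr rfl fun _ _ => Finset.sum_congr rfl fun _ _ => by ring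

/-- The second Reidemeister move on matrix entries. -/
theorem sum_orderedProduct_reidemeister2 (A : Rˣ)
    (hd : (Fintype.card K : R) = -(A : R) ^ 2 - ((A⁻¹ : Rˣ) : R) ^ 2) (e c : ℤˣ)
    (i₁ j₁ i₂ j₂ : K) :
    ∑ p, ∑ q, (strandMatrix A e true p * strandMatrix A (-e) true q) i₁ j₁ *
        orderedProduct c (strandMatrix A e false p) (strandMatrix A (-e) false q) i₂ j₂ =
      (1 : Matrix K K R) i₁ j₁ * (1 : Matrix K K R) i₂ j₂ := by
  have key : ∀ i₁ j₁ i₂ j₂ : K, ∑ p : Bool × K × K, ∑ q : Bool × K × K,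
        (signTranspose 1 (strandMatrix (R := R) A e true p) *
          signTranspose 1 (strandMatrix A (-e) true q)) i₁ j₁ *
        (signTranspose c (strandMatrix A e false p) *
          signTranspose c (strandMatrix A (-e) false q)) i₂ j₂ =
      (1 : Matrix K K R) i₁ j₁ * (1 : Matrix K K R) i₂ j₂ := by
    intro i₁ j₁ i₂ j₂
    simp only [Matrix.mul_apply]
    rw [sum_mul_comm]
    have hr : ∀ x y : R, writheFactor A e * x * (writheFactor A (-e) * y) = x * y := by
      intro x y
      linear_combination x * y * writheFactor_mul_neg A e
    simp only [sum_strandMatrix, hr]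
    rw [← crossingKernel_mul_inverse (s := ((A ^ ((e * c : ℤˣ) : ℤ) : Rˣ) : R))
      (t := ((A ^ (-((e * c : ℤˣ) : ℤ)) : Rˣ) : R)) (by rw [← Units.val_mul, ← zpow_add]; simp)
      (by
        rw [hd]
        rcases Int.units_eq_one_or (e * c) with h | h <;> rw [h] <;> simp
        ring)]
    simp
  rw [← show (if c = 1 then (1 : Matrix K K R) i₂ j₂ else (1 : Matrix K K R) j₂ i₂) =
    (1 : Matrix K K R) i₂ j₂ by rw [one_apply_comm j₂ i₂, ite_self]]
  simp only [orderedProduct_eq, signTranspose_apply _ (_ * _)]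
  split_ifs
  · exact key i₁ j₁ i₂ j₂
  · exact key i₁ j₁ j₂ i₂

/-- The first Reidemeister move on matrices. -/
theorem sum_strandMatrix_reidemeister1 (A : Rˣ)
    (hd : (Fintype.card K : R) = -(A : R) ^ 2 - ((A⁻¹ : Rˣ) : R) ^ 2) (e : ℤˣ) (o : Bool) :
    ∑ p : Bool × K × K, strandMatrix A e o p * strandMatrix A e (!o) p = 1 := by
  have hs : ∀ i j k l : K, ∑ q : Bool × K × K, strandMatrix A e true q i j *
      strandMatrix A e false q k l = _ := fun i j k l => by
    simpa [signTranspose] using sum_strandMatrix A e 1 1 i j k l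
  have hA : (A : R) * ((A⁻¹ : Rˣ) : R) = 1 := by simp
  -- A kink contributes `A^e d + A^(-e) = (-A^3)^e`, which the writhe factor cancels.
  have hf : ∀ i j : K, (if i = j then ((A ^ (e : ℤ) : Rˣ) : R) * Fintype.card K +
      (((A ^ (e : ℤ))⁻¹ : Rˣ) : R) else 0) * writheFactor A e = (1 : Matrix K K R) i j := by
    intro i j
    rw [Matrix.one_apply]
    split_ifs
    · rw [hd]
      rcases Int.units_eq_one_or e with rfl | rfl
      · have h3 : ((writheFactor A 1 : Rˣ) : R) = -((A⁻¹ : Rˣ) : R) ^ 3 := by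
          simp [writheFactor, ← inv_pow, inv_neg]
        rw [h3]
        simp
        generalize ((A⁻¹ : Rˣ) : R) = B at *
        linear_combination (((A : R) * B) ^ 2 + A * B + 1 + B ^ 4) * hA
      · have h3 : ((writheFactor A (-1) : Rˣ) : R) = -(A : R) ^ 3 := by
          simp [writheFactor]
        rw [h3]
        simp
        generalize ((A⁻¹ : Rˣ) : R) = B at *
        linear_combination (((A : R) * B) ^ 2 + A * B + 1 + (A : R) ^ 4) * hA
    · simp
  ext i j
  rw [Matrix.sum_apply, ← hf]
  simp only [Matrix.mul_apply]
  rw [Finset.sum_comm]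
  cases o
  · simp only [mul_comm (strandMatrix A e false _ _ _), Bool.not_false, hs, crossingKernel]
    rw [← Finset.mul_sum, Finset.sum_add_distrib, mul_comm]
    by_cases h : i = j <;> simp [h, eq_comm, mul_comm]
  · simp only [Bool.not_true, hs, crossingKernel]
    rw [← Finset.mul_sum, Finset.sum_add_distrib, mul_comm]
    by_cases h : i = j <;> simp [h, eq_comm, mul_comm]

/-- The entries of the pieces `P`, `Q` changed by a move are separated from those of the rest `U`,
`V`, so an identity between entries of the pieces passes to the trace. -/
theorem trace_mul_four (P U Q V : Matrix K K R) : (P * U * Q * V).trace =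
    ∑ x : K × K × K × K, P x.1 x.2.1 * Q x.2.2.1 x.2.2.2 * (U x.2.1 x.2.2.1 * V x.2.2.2 x.1) := by
  have h : P * U * Q * V = P * (U * (Q * V)) := by simp only [Matrix.mul_assoc]
  rw [h]
  simp only [Matrix.trace, Matrix.diag, Matrix.mul_apply, Finset.mul_sum, Fintype.sum_prod_type]
  iterate 4 refine Finset.sum_congr rfl fun _ _ => ?_
  ring

theorem trace_mul_six (P U Q V S W : Matrix K K R) : (P * U * Q * V * S * W).trace =
    ∑ x : K × K × K × K × K × K, P x.1 x.2.1 * Q x.2.2.1 x.2.2.2.1 * S x.2.2.2.2.1 x.2.2.2.2.2 *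
      (U x.2.1 x.2.2.1 * V x.2.2.2.1 x.2.2.2.2.1 * W x.2.2.2.2.2 x.1) := by
  have h : P * U * Q * V * S * W = P * (U * (Q * (V * (S * W)))) := by simp only [Matrix.mul_assoc]
  rw [h]
  simp only [Matrix.trace, Matrix.diag, Matrix.mul_apply, Finset.mul_sum, Fintype.sum_prod_type]
  iterate 6 refine Finset.sum_congr rfl fun _ _ => ?_
  ring

theorem sum_sum_eq {α β : Type*} [Fintype α] [Fintype β] (F : α → β → R) :
    ∑ p, ∑ q, F p q = ∑ x : α × β, F x.1 x.2 := by
  rw [Fintype.sum_prod_type]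

theorem sum_sum_sum_eq {α β γ : Type*} [Fintype α] [Fintype β] [Fintype γ] (F : α → β → γ → R) :
    ∑ p, ∑ q, ∑ r, F p q r = ∑ x : α × β × γ, F x.1 x.2.1 x.2.2 := by
  simp only [Fintype.sum_prod_type]

/-- The second Reidemeister move on traces. -/
theorem sum_trace_reidemeister2 (A : Rˣ)
    (hd : (Fintype.card K : R) = -(A : R) ^ 2 - ((A⁻¹ : Rˣ) : R) ^ 2) (e c : ℤˣ)
    (U V : Matrix K K R) :
    ∑ p, ∑ q, (strandMatrix A e true p * strandMatrix A (-e) true q * U *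
        orderedProduct c (strandMatrix A e false p) (strandMatrix A (-e) false q) * V).trace =
      (U * V).trace := by
  have h1 : (U * V).trace = (1 * U * 1 * V).trace := by simp
  simp only [h1, trace_mul_four]
  rw [sum_sum_eq, Finset.sum_comm]
  refine Finset.sum_congr rfl fun x _ => ?_
  rw [← Finset.sum_mul, ← sum_orderedProduct_reidemeister2 A hd e c, sum_sum_eq]

/-- The third Reidemeister move on traces, for the cyclic order top, middle, bottom. -/
theorem sum_trace_reidemeister3_tmb (A : Rˣ)
    (hd : (Fintype.card K : R) = -(A : R) ^ 2 - ((A⁻¹ : Rˣ) : R) ^ 2) (a b c : ℤˣ)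
    (U V W : Matrix K K R) :
    ∑ p, ∑ q, ∑ r, (orderedProduct b (strandMatrix A a true p) (strandMatrix A b true q) * U *
        orderedProduct c (strandMatrix A a false p) (strandMatrix A c true r) * V *
        orderedProduct (a * b * c) (strandMatrix A b false q) (strandMatrix A c false r) *
        W).trace =
      ∑ p, ∑ q, ∑ r,
        (orderedProduct (-b) (strandMatrix A a true p) (strandMatrix A b true q) * U *
        orderedProduct (-c) (strandMatrix A a false p) (strandMatrix A c true r) * V *
        orderedProduct (-(a * b * c)) (strandMatrix A b false q) (strandMatrix A c false r) *
        W).trace := by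
  simp only [trace_mul_six]
  rw [sum_sum_sum_eq, sum_sum_sum_eq]
  refine (Finset.sum_comm.trans (Finset.sum_congr rfl fun x _ => ?_)).trans Finset.sum_comm
  rw [← Finset.sum_mul, ← Finset.sum_mul]
  have := sum_orderedProduct_reidemeister3 A hd a b c x.1 x.2.1 x.2.2.1 x.2.2.2.1 x.2.2.2.2.1
    x.2.2.2.2.2
  rw [sum_sum_sum_eq, sum_sum_sum_eq] at this
  rw [this]

/-- The third Reidemeister move on traces, for the cyclic order top, bottom, middle. -/
theorem sum_trace_reidemeister3_tbm (A : Rˣ)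
    (hd : (Fintype.card K : R) = -(A : R) ^ 2 - ((A⁻¹ : Rˣ) : R) ^ 2) (a b c : ℤˣ)
    (U V W : Matrix K K R) :
    ∑ p, ∑ q, ∑ r, (orderedProduct b (strandMatrix A a true p) (strandMatrix A b true q) * U *
        orderedProduct (a * b * c) (strandMatrix A b false q) (strandMatrix A c false r) * V *
        orderedProduct c (strandMatrix A a false p) (strandMatrix A c true r) * W).trace =
      ∑ p, ∑ q, ∑ r,
        (orderedProduct (-b) (strandMatrix A a true p) (strandMatrix A b true q) * U *
        orderedProduct (-(a * b * c)) (strandMatrix A b false q) (strandMatrix A c false r) * V *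
        orderedProduct (-c) (strandMatrix A a false p) (strandMatrix A c true r) * W).trace := by
  simp only [trace_mul_six]
  rw [sum_sum_sum_eq, sum_sum_sum_eq]
  refine (Finset.sum_comm.trans (Finset.sum_congr rfl fun x _ => ?_)).trans Finset.sum_comm
  rw [← Finset.sum_mul, ← Finset.sum_mul]
  have := sum_orderedProduct_reidemeister3 A hd a b c x.1 x.2.1 x.2.2.2.2.1 x.2.2.2.2.2
    x.2.2.1 x.2.2.2.1
  rw [sum_sum_sum_eq, sum_sum_sum_eq] at this
  simp only [mul_right_comm _ (orderedProduct (a * b * c) _ _ _ _),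
    mul_right_comm _ (orderedProduct (-(a * b * c)) _ _ _ _)]
  rw [this]

end LetterMatrix

/-! ### The state sum of a Gauss word -/

/-- The list of the crossings of a Gauss word. -/
def overList (w : List GaussLetter) : List ℕ :=
  (w.filter fun l => l.isOver).map GaussLetter.crossing

theorem List.Perm.overList {u v : List GaussLetter} (h : u.Perm v) :
    (overList u).Perm (overList v) :=
  (h.filter _).map _

/-- No endpoint of an arrow occurs twice. -/
def NodupLetters (w : List GaussLetter) : Prop := (w.map fun l => (l.crossing, l.isOver)).Nodup

theorem NodupLetters.perm {u v : List GaussLetter} (h : NodupLetters u) (huv : u.Perm v) :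
    NodupLetters v :=
  (huv.map _).nodup_iff.1 h

theorem NodupLetters.tail {l : GaussLetter} {w : List GaussLetter} (h : NodupLetters (l :: w)) :
    NodupLetters w :=
  (List.nodup_cons.1 h).2

theorem NodupLetters.overList {w : List GaussLetter} (h : NodupLetters w) : (overList w).Nodup := by
  induction w with
  | nil => exact List.nodup_nil
  | cons l w ih =>
    have hl := (List.nodup_cons.1 h).1
    obtain ⟨x, o, e⟩ := l
    cases o
    · exact ih h.tail
    · refine List.nodup_cons.2 ⟨fun hx => hl ?_, ih h.tail⟩
      simp only [List.mem_map, List.mem_filter] at hx ⊢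
      obtain ⟨m, ⟨hm, ho⟩, rfl⟩ := hx
      exact ⟨m, hm, by simp [ho]⟩

theorem NodupLetters.not_mem {x : ℕ} {e e' : ℤˣ} {w : List GaussLetter}
    (h : NodupLetters (⟨x, true, e⟩ :: ⟨x, false, e'⟩ :: w)) : ∀ l ∈ w, l.crossing ≠ x := by
  rintro ⟨y, o, e''⟩ hl rfl
  simp only [NodupLetters, List.map_cons, List.nodup_cons, List.mem_cons, List.mem_map] at h
  cases o
  · exact h.2.1 ⟨_, hl, rfl⟩
  · exact h.1 (Or.inr ⟨_, hl, rfl⟩)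

section StateSum

variable {K R : Type*} [Fintype K] [DecidableEq K] [CommRing R]

/-- The product of the matrices of the letters of a word. -/
def wordMatrix (A : Rˣ) (w : List GaussLetter) (ω : ℕ → Bool × K × K) : Matrix K K R :=
  (w.map fun l => strandMatrix A l.sign l.isOver (ω l.crossing)).prod

theorem wordMatrix_append (A : Rˣ) (u v : List GaussLetter) (ω : ℕ → Bool × K × K) :
    wordMatrix A (u ++ v) ω = wordMatrix A u ω * wordMatrix A v ω := by
  simp [wordMatrix]

theorem wordMatrix_update (A : Rˣ) {w : List GaussLetter} {x : ℕ} (hx : ∀ l ∈ w, l.crossing ≠ x)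
    (ω : ℕ → Bool × K × K) (p : Bool × K × K) :
    wordMatrix A w (Function.update ω x p) = wordMatrix A w ω := by
  unfold wordMatrix
  congr 1
  refine List.map_congr_left fun l hl => ?_
  rw [Function.update_of_ne (hx l hl)]

theorem wordMatrix_pair (A : Rˣ) (l l' : GaussLetter) (ω : ℕ → Bool × K × K) :
    wordMatrix A [l, l'] ω = strandMatrix A l.sign l.isOver (ω l.crossing) *
      strandMatrix A l'.sign l'.isOver (ω l'.crossing) := by
  simp [wordMatrix]

theorem wordMatrix_orderedPair (A : Rˣ) (b : ℤˣ) (l l' : GaussLetter) (ω : ℕ → Bool × K × K) :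
    wordMatrix A (orderedPair b l l') ω =
      orderedProduct b (strandMatrix A l.sign l.isOver (ω l.crossing))
        (strandMatrix A l'.sign l'.isOver (ω l'.crossing)) := by
  unfold orderedPair orderedProduct
  split_ifs <;> exact wordMatrix_pair ..

variable [Inhabited K]

/-- The sum over all states of a Gauss word and all colourings of their curves by `K`. -/
def stateSum (K : Type*) [Fintype K] [DecidableEq K] [Inhabited K] (A : Rˣ)
    (w : List GaussLetter) : R :=
  sumOver (overList w) fun ω : ℕ → Bool × K × K => (wordMatrix A w ω).trace

theorem orderedPair_one (l l' : GaussLetter) : orderedPair 1 l l' = [l, l'] := if_pos rfl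

theorem orderedPair_neg_one (l l' : GaussLetter) : orderedPair (-1) l l' = [l', l] :=
  if_neg (by decide)

theorem orderedPair_perm (b : ℤˣ) (l l' : GaussLetter) : (orderedPair b l l').Perm [l, l'] := by
  unfold orderedPair
  split_ifs
  · exact List.Perm.refl _
  · exact List.Perm.swap _ _ _

theorem stateSum_rotate (A : Rˣ) (u v : List GaussLetter) (h : NodupLetters (u ++ v)) :
    stateSum K A (u ++ v) = stateSum K A (v ++ u) := by
  unfold stateSum
  rw [sumOver_perm List.perm_append_comm.overList h.overList]
  refine sumOver_congr fun ω => ?_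
  rw [wordMatrix_append, wordMatrix_append, Matrix.trace_mul_comm]

theorem stateSum_relabel (A : Rˣ) (σ : Equiv.Perm ℕ) (w : List GaussLetter) :
    stateSum K A (w.map fun l => ⟨σ l.crossing, l.isOver, l.sign⟩) = stateSum K A w := by
  have h : overList (w.map fun l => ⟨σ l.crossing, l.isOver, l.sign⟩) = (overList w).map σ := by
    simp [overList, List.filter_map, Function.comp_def]
  unfold stateSum
  rw [h, sumOver_map_equiv]
  refine sumOver_congr fun ω => ?_
  simp [wordMatrix, Function.comp_def]

theorem stateSum_reidemeister1 (A : Rˣ)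
    (hd : (Fintype.card K : R) = -(A : R) ^ 2 - ((A⁻¹ : Rˣ) : R) ^ 2) (x : ℕ) (o : Bool) (e : ℤˣ)
    (w : List GaussLetter) (h : NodupLetters ([⟨x, o, e⟩, ⟨x, !o, e⟩] ++ w)) :
    stateSum K A ([⟨x, o, e⟩, ⟨x, !o, e⟩] ++ w) = stateSum K A w := by
  have hx : ∀ l ∈ w, l.crossing ≠ x := by
    cases o
    · exact (h.perm (List.Perm.swap _ _ _)).not_mem
    · exact h.not_mem
  have hl : overList ([⟨x, o, e⟩, ⟨x, !o, e⟩] ++ w) = x :: overList w := by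
    cases o <;> simp [overList]
  unfold stateSum
  rw [hl, sumOver_cons, ← sumOver_sum]
  refine sumOver_congr fun ω => ?_
  simp only [wordMatrix_append, wordMatrix_update A hx, wordMatrix_pair, Function.update_self]
  rw [← Matrix.trace_sum, ← Finset.sum_mul, sum_strandMatrix_reidemeister1 A hd, one_mul]

theorem perm_of_reidemeister2 (c : ℤˣ) (x x' y y' : GaussLetter) (u v : List GaussLetter) :
    ([x, y] ++ u ++ orderedPair c x' y' ++ v).Perm (x :: x' :: y :: y' :: (u ++ v)) := by
  refine (((orderedPair_perm c _ _).append_left _).append_right _).trans ?_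
  rw [List.perm_iff_count]
  intro l
  simp only [List.count_append, List.count_cons, List.count_nil]
  ring

theorem perm_of_reidemeister3_tmb (a b c : ℤˣ) (x x' y y' z z' : GaussLetter)
    (u v w : List GaussLetter) :
    (orderedPair a x y ++ u ++ orderedPair b x' z ++ v ++ orderedPair c y' z' ++ w).Perm
      (x :: x' :: y :: y' :: z :: z' :: (u ++ (v ++ w))) := by
  rw [List.perm_iff_count]
  intro l
  simp only [List.count_append, List.count_cons, (orderedPair_perm _ _ _).count_eq, List.count_nil]
  ring

theorem perm_of_reidemeister3_tbm (a b c : ℤˣ) (x x' y y' z z' : GaussLetter)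
    (u v w : List GaussLetter) :
    (orderedPair a x y ++ u ++ orderedPair c y' z' ++ v ++ orderedPair b x' z ++ w).Perm
      (x :: x' :: y :: y' :: z :: z' :: (u ++ (v ++ w))) := by
  rw [List.perm_iff_count]
  intro l
  simp only [List.count_append, List.count_cons, (orderedPair_perm _ _ _).count_eq, List.count_nil]
  ring

theorem stateSum_reidemeister2 (A : Rˣ)
    (hd : (Fintype.card K : R) = -(A : R) ^ 2 - ((A⁻¹ : Rˣ) : R) ^ 2) (x y : ℕ) (e c : ℤˣ)
    (u v : List GaussLetter)
    (h : NodupLetters ([⟨x, true, e⟩, ⟨y, true, -e⟩] ++ u ++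
      orderedPair c ⟨x, false, e⟩ ⟨y, false, -e⟩ ++ v)) :
    stateSum K A ([⟨x, true, e⟩, ⟨y, true, -e⟩] ++ u ++
      orderedPair c ⟨x, false, e⟩ ⟨y, false, -e⟩ ++ v) = stateSum K A (u ++ v) := by
  have hp := perm_of_reidemeister2 c ⟨x, true, e⟩ ⟨x, false, e⟩ ⟨y, true, -e⟩ ⟨y, false, -e⟩ u v
  have hn := h.perm hp
  have hx := hn.not_mem
  have hy := hn.tail.tail.not_mem
  have hyx : y ≠ x := hx _ (List.mem_cons_self)
  simp only [List.mem_cons, List.mem_append, or_imp, forall_and] at hx hy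
  obtain ⟨-, -, hxu, hxv⟩ := hx
  obtain ⟨hyu, hyv⟩ := hy
  unfold stateSum
  rw [sumOver_perm hp.overList h.overList]
  change sumOver (x :: y :: overList (u ++ v)) _ = _
  simp only [sumOver_cons, ← sumOver_sum]
  refine sumOver_congr fun ω => ?_
  simp only [wordMatrix_append, wordMatrix_update A hxu, wordMatrix_update A hxv,
    wordMatrix_update A hyu, wordMatrix_update A hyv, wordMatrix_pair, wordMatrix_orderedPair,
    Function.update_self, Function.update_of_ne hyx]
  exact sum_trace_reidemeister2 A hd e c _ _

theorem stateSum_reidemeister3_tmb (A : Rˣ)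
    (hd : (Fintype.card K : R) = -(A : R) ^ 2 - ((A⁻¹ : Rˣ) : R) ^ 2) (x y z : ℕ) (a b c : ℤˣ)
    (u v w : List GaussLetter)
    (h : NodupLetters (orderedPair b ⟨x, true, a⟩ ⟨y, true, b⟩ ++ u ++
          orderedPair c ⟨x, false, a⟩ ⟨z, true, c⟩ ++ v ++
          orderedPair (a * b * c) ⟨y, false, b⟩ ⟨z, false, c⟩ ++ w)) :
    stateSum K A (orderedPair b ⟨x, true, a⟩ ⟨y, true, b⟩ ++ u ++
          orderedPair c ⟨x, false, a⟩ ⟨z, true, c⟩ ++ v ++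
          orderedPair (a * b * c) ⟨y, false, b⟩ ⟨z, false, c⟩ ++ w) =
      stateSum K A (orderedPair (-b) ⟨x, true, a⟩ ⟨y, true, b⟩ ++ u ++
          orderedPair (-c) ⟨x, false, a⟩ ⟨z, true, c⟩ ++ v ++
          orderedPair (-(a * b * c)) ⟨y, false, b⟩ ⟨z, false, c⟩ ++ w) := by
  have hp := fun a' b' c' : ℤˣ => perm_of_reidemeister3_tmb a' b' c' ⟨x, true, a⟩ ⟨x, false, a⟩
    ⟨y, true, b⟩ ⟨y, false, b⟩ ⟨z, true, c⟩ ⟨z, false, c⟩ u v w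
  have hn := h.perm (hp _ _ _)
  have hx := hn.not_mem
  have hy := hn.tail.tail.not_mem
  have hz := hn.tail.tail.tail.tail.not_mem
  simp only [List.mem_cons, List.mem_append, or_imp, forall_and, forall_eq] at hx hy hz
  obtain ⟨hyx, -, hzx, -, hxu, hxv, hxw⟩ := hx
  obtain ⟨hzy, -, hyu, hyv, hyw⟩ := hy
  obtain ⟨hzu, hzv, hzw⟩ := hz
  unfold stateSum
  rw [sumOver_perm (hp _ _ _).overList h.overList,
    sumOver_perm (hp _ _ _).overList (hn.perm (hp _ _ _).symm).overList]
  change sumOver (x :: y :: z :: overList (u ++ (v ++ w))) _ =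
    sumOver (x :: y :: z :: overList (u ++ (v ++ w))) _
  simp only [sumOver_cons, ← sumOver_sum]
  refine sumOver_congr fun ω => ?_
  simp only [wordMatrix_append, wordMatrix_update A hxu, wordMatrix_update A hxv,
    wordMatrix_update A hxw, wordMatrix_update A hyu, wordMatrix_update A hyv,
    wordMatrix_update A hyw, wordMatrix_update A hzu, wordMatrix_update A hzv,
    wordMatrix_update A hzw, wordMatrix_orderedPair, Function.update_self,
    Function.update_of_ne hyx, Function.update_of_ne hzx, Function.update_of_ne hzy]
  exact sum_trace_reidemeister3_tmb A hd a b c _ _ _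

theorem stateSum_reidemeister3_tbm (A : Rˣ)
    (hd : (Fintype.card K : R) = -(A : R) ^ 2 - ((A⁻¹ : Rˣ) : R) ^ 2) (x y z : ℕ) (a b c : ℤˣ)
    (u v w : List GaussLetter)
    (h : NodupLetters (orderedPair b ⟨x, true, a⟩ ⟨y, true, b⟩ ++ u ++
          orderedPair (a * b * c) ⟨y, false, b⟩ ⟨z, false, c⟩ ++ v ++
          orderedPair c ⟨x, false, a⟩ ⟨z, true, c⟩ ++ w)) :
    stateSum K A (orderedPair b ⟨x, true, a⟩ ⟨y, true, b⟩ ++ u ++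
          orderedPair (a * b * c) ⟨y, false, b⟩ ⟨z, false, c⟩ ++ v ++
          orderedPair c ⟨x, false, a⟩ ⟨z, true, c⟩ ++ w) =
      stateSum K A (orderedPair (-b) ⟨x, true, a⟩ ⟨y, true, b⟩ ++ u ++
          orderedPair (-(a * b * c)) ⟨y, false, b⟩ ⟨z, false, c⟩ ++ v ++
          orderedPair (-c) ⟨x, false, a⟩ ⟨z, true, c⟩ ++ w) := by
  have hp := fun a' b' c' : ℤˣ => perm_of_reidemeister3_tbm a' b' c' ⟨x, true, a⟩ ⟨x, false, a⟩
    ⟨y, true, b⟩ ⟨y, false, b⟩ ⟨z, true, c⟩ ⟨z, false, c⟩ u v w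
  have hn := h.perm (hp _ _ _)
  have hx := hn.not_mem
  have hy := hn.tail.tail.not_mem
  have hz := hn.tail.tail.tail.tail.not_mem
  simp only [List.mem_cons, List.mem_append, or_imp, forall_and, forall_eq] at hx hy hz
  obtain ⟨hyx, -, hzx, -, hxu, hxv, hxw⟩ := hx
  obtain ⟨hzy, -, hyu, hyv, hyw⟩ := hy
  obtain ⟨hzu, hzv, hzw⟩ := hz
  unfold stateSum
  rw [sumOver_perm (hp _ _ _).overList h.overList,
    sumOver_perm (hp _ _ _).overList (hn.perm (hp _ _ _).symm).overList]
  change sumOver (x :: y :: z :: overList (u ++ (v ++ w))) _ =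
    sumOver (x :: y :: z :: overList (u ++ (v ++ w))) _
  simp only [sumOver_cons, ← sumOver_sum]
  refine sumOver_congr fun ω => ?_
  simp only [wordMatrix_append, wordMatrix_update A hxu, wordMatrix_update A hxv,
    wordMatrix_update A hxw, wordMatrix_update A hyu, wordMatrix_update A hyv,
    wordMatrix_update A hyw, wordMatrix_update A hzu, wordMatrix_update A hzv,
    wordMatrix_update A hzw, wordMatrix_orderedPair, Function.update_self,
    Function.update_of_ne hyx, Function.update_of_ne hzx, Function.update_of_ne hzy]
  exact sum_trace_reidemeister3_tbm A hd a b c _ _ _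

/-- The state sum is invariant under virtual isotopy. -/
theorem stateSum_eq_of_gaussMove (A : Rˣ)
    (hd : (Fintype.card K : R) = -(A : R) ^ 2 - ((A⁻¹ : Rˣ) : R) ^ 2) {w w' : List GaussLetter}
    (h : GaussMove w w') (hw : NodupLetters w) : stateSum K A w = stateSum K A w' := by
  cases h with
  | rotate u v => exact stateSum_rotate A u v hw
  | relabel σ => exact (stateSum_relabel A σ w).symm
  | reidemeister1 x o e => exact stateSum_reidemeister1 A hd x o e w' hw
  | reidemeister2_parallel x y e u v =>
    have hr := stateSum_reidemeister2 (K := K) A hd x y e 1 u v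
    rw [orderedPair_one] at hr
    exact hr hw
  | reidemeister2_antiparallel x y e u v =>
    have hr := stateSum_reidemeister2 (K := K) A hd x y e (-1) u v
    rw [orderedPair_neg_one] at hr
    exact hr hw
  | reidemeister3_tmb x y z a b c u v w =>
    exact stateSum_reidemeister3_tmb A hd x y z a b c u v w hw
  | reidemeister3_tbm x y z a b c u v w =>
    exact stateSum_reidemeister3_tbm A hd x y z a b c u v w hw

end StateSum

/-! ### Closed curves of a state and colourings -/

namespace GaussDiagram

theorem eq_of_mem_word (D : GaussDiagram) {l l' : GaussLetter} (hl : l ∈ D.word) (hl' : l' ∈ D.word)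
    (hc : l.crossing = l'.crossing) (ho : l.isOver = l'.isOver) : l = l' :=
  List.inj_on_of_nodup_map D.nodup hl hl' (by rw [hc, ho])

theorem sign_eq_of_mem_word (D : GaussDiagram) {l l' : GaussLetter} (hl : l ∈ D.word)
    (hl' : l' ∈ D.word) (hc : l.crossing = l'.crossing) : l.sign = l'.sign := by
  by_cases ho : l.isOver = l'.isOver
  · rw [D.eq_of_mem_word hl hl' hc ho]
  · rw [D.eq_of_mem_word hl (D.paired l' hl') hc (Bool.eq_not_of_ne ho)]

theorem nodup_word (D : GaussDiagram) : D.word.Nodup := D.nodup.of_map _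

theorem toFinset_overList (D : GaussDiagram) : (overList D.word).toFinset = D.crossings := by
  ext x
  simp only [overList, crossings, List.mem_toFinset, List.mem_map, List.mem_filter]
  constructor
  · rintro ⟨l, ⟨hl, -⟩, rfl⟩
    exact ⟨l, hl, rfl⟩
  · rintro ⟨l, hl, rfl⟩
    cases ho : l.isOver
    · exact ⟨_, ⟨D.paired l hl, by simp [ho]⟩, rfl⟩
    · exact ⟨l, ⟨hl, ho⟩, rfl⟩

theorem mem_overList (D : GaussDiagram) {l : GaussLetter} (hl : l ∈ D.word) :
    l.crossing ∈ overList D.word := by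
  rw [← List.mem_toFinset, toFinset_overList, crossings, List.mem_toFinset]
  exact List.mem_map_of_mem hl

/-- The condition `crossing ∈ S ↔ sign = 1` says that the smoothing respects the orientation. The
colours on the underpass are then those on the overpass in exchanged order; otherwise they come in
the same order. -/
theorem colouring_iff (D : GaussDiagram) (S : Finset ℕ) {K : Type*}
    (c : Fin (D.word.length + 1) → K) :
    (∀ a b, D.StateJoined S a b → c a = c b) ↔ c 0 = c (Fin.last _) ∧
      ∀ i j, D.IsCrossingAt i j →
        if (D.word.get i).crossing ∈ S ↔ (D.word.get i).sign = 1
        then (c i.castSucc, c i.succ) = (c j.succ, c j.castSucc)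
        else (c i.castSucc, c i.succ) = (c j.castSucc, c j.succ) := by
  constructor
  · intro h
    refine ⟨h _ _ .basePoint, fun i j hij => ?_⟩
    by_cases hS : (D.word.get i).crossing ∈ S
    · have h1 := h _ _ (.smoothA₁ i j hij hS)
      have h2 := h _ _ (.smoothA₂ i j hij hS)
      by_cases he : (D.word.get i).sign = 1 <;> simp_all [arcsAround]
    · have h1 := h _ _ (.smoothB₁ i j hij hS)
      have h2 := h _ _ (.smoothB₂ i j hij hS)
      by_cases he : (D.word.get i).sign = 1 <;> simp_all [arcsAround]
  · rintro ⟨h0, h⟩ a b hab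
    cases hab with
    | basePoint => exact h0
    | smoothA₁ i j hij hS =>
      have := h i j hij
      by_cases he : (D.word.get i).sign = 1 <;> simp_all [arcsAround]
    | smoothA₂ i j hij hS =>
      have := h i j hij
      by_cases he : (D.word.get i).sign = 1 <;> simp_all [arcsAround]
    | smoothB₁ i j hij hS =>
      have := h i j hij
      by_cases he : (D.word.get i).sign = 1 <;> simp_all [arcsAround]
    | smoothB₂ i j hij hS =>
      have := h i j hij
      by_cases he : (D.word.get i).sign = 1 <;> simp_all [arcsAround]

end GaussDiagram

theorem Matrix.list_ofFn_prod_apply {K R : Type*} [Fintype K] [DecidableEq K] [CommRing R] {n : ℕ}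
    (M : Fin n → Matrix K K R) (a b : K) :
    (List.ofFn M).prod a b = ∑ c : Fin (n + 1) → K,
      if c 0 = a ∧ c (Fin.last n) = b then ∏ i, M i (c i.castSucc) (c i.succ) else 0 := by
  induction n generalizing a with
  | zero =>
    rw [← (Equiv.funUnique (Fin 1) K).symm.sum_comp]
    simp [Matrix.one_apply, ite_and]
  | succ n ih =>
    rw [List.ofFn_succ, List.prod_cons, Matrix.mul_apply,
      ← (Fin.consEquiv fun _ : Fin (n + 2) => K).sum_comp, Fintype.sum_prod_type]
    have h0 : ∀ (x : K) (c : Fin (n + 1) → K), (if (Fin.cons x c : Fin (n + 2) → K) 0 = a ∧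
        (Fin.cons x c : Fin (n + 2) → K) (Fin.last (n + 1)) = b then
        ∏ i, M i ((Fin.cons x c : Fin (n + 2) → K) i.castSucc)
          ((Fin.cons x c : Fin (n + 2) → K) i.succ) else 0) =
        if x = a then if c (Fin.last n) = b then
          M 0 x (c 0) * ∏ i : Fin n, M i.succ (c i.castSucc) (c i.succ) else 0 else 0 := by
      intro x c
      rw [← Fin.succ_last, ite_and]
      simp only [Fin.cons_zero, Fin.cons_succ, Fin.prod_univ_succ, Fin.castSucc_zero,
        ← Fin.succ_castSucc]
    simp only [ih, Fin.consEquiv_apply, h0, Finset.mul_sum]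
    rw [Finset.sum_comm, Finset.sum_comm (s := Finset.univ (α := K))]
    refine Finset.sum_congr rfl fun c _ => ?_
    simp [ite_and]

section Colouring

variable {K R : Type*} [Fintype K] [DecidableEq K] [CommRing R]

/-- The matrix of a strand at a smoothed crossing, where the crossings in `S` are `A`-smoothed and
`p` contains the colours of the two curves of the smoothing. -/
def smoothMatrix (S : Finset ℕ) (l : GaussLetter) (p : K × K) : Matrix K K R :=
  if l.isOver then Matrix.single p.1 p.2 1
  else if l.crossing ∈ S ↔ l.sign = 1 then Matrix.single p.2 p.1 1 else Matrix.single p.1 p.2 1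

/-- The colours of the curves of a smoothing, from the colours of a strand before and after it. -/
def smoothColours (S : Finset ℕ) (l : GaussLetter) (a b : K) : K × K :=
  if l.isOver then (a, b) else if l.crossing ∈ S ↔ l.sign = 1 then (b, a) else (a, b)

theorem smoothMatrix_apply (S : Finset ℕ) (l : GaussLetter) (p : K × K) (a b : K) :
    (smoothMatrix S l p a b : R) = if p = smoothColours S l a b then 1 else 0 := by
  unfold smoothMatrix smoothColours
  split_ifs <;> simp_all [Prod.ext_iff, and_comm]

variable [Inhabited K]

/-- The number of colourings of the closed curves of a state. -/
def colouringSum (K R : Type*) [Fintype K] [DecidableEq K] [Inhabited K] [CommRing R]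
    (S : Finset ℕ) (w : List GaussLetter) : R :=
  sumOver (overList w) fun r : ℕ → K × K =>
    ((w.map fun l => (smoothMatrix S l (r l.crossing) : Matrix K K R)).prod).trace

theorem trace_smoothMatrix (S : Finset ℕ) (w : List GaussLetter) (r : ℕ → K × K) :
    ((w.map fun l => (smoothMatrix S l (r l.crossing) : Matrix K K R)).prod).trace =
      ∑ c : Fin (w.length + 1) → K, if c 0 = c (Fin.last _) ∧ ∀ i, r (w.get i).crossing =
        smoothColours S (w.get i) (c i.castSucc) (c i.succ) then 1 else 0 := by
  have h : (w.map fun l => (smoothMatrix S l (r l.crossing) : Matrix K K R)) =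
      List.ofFn fun i => smoothMatrix S (w.get i) (r (w.get i).crossing) := by
    conv_lhs => rw [← List.ofFn_get w, List.map_ofFn]
    rfl
  rw [h, Matrix.trace]
  simp only [Matrix.diag, Matrix.list_ofFn_prod_apply]
  rw [Finset.sum_comm]
  refine Finset.sum_congr rfl fun c _ => ?_
  simp only [smoothMatrix_apply, Finset.prod_ite_zero]
  rw [Finset.sum_eq_single (c 0)]
  · simp [ite_and, eq_comm]
  · intro x _ hx
    rw [if_neg fun h => hx h.1.symm]
  · simp

/-- The label of a crossing can be read off at its overpass, so only the underpass imposes a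
condition on the colouring of the arcs. -/
theorem GaussDiagram.exists_smoothColours_iff (D : GaussDiagram) (S : Finset ℕ)
    (c : Fin (D.word.length + 1) → K) :
    (∃ r : ℕ → K × K, ∀ i, r (D.word.get i).crossing =
        smoothColours S (D.word.get i) (c i.castSucc) (c i.succ)) ↔
      ∀ i j, D.IsCrossingAt i j →
        if (D.word.get i).crossing ∈ S ↔ (D.word.get i).sign = 1
        then (c i.castSucc, c i.succ) = (c j.succ, c j.castSucc)
        else (c i.castSucc, c i.succ) = (c j.castSucc, c j.succ) := by
  classical
  constructor
  · rintro ⟨r, hr⟩ i j ⟨hi, hj, hij⟩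
    have h1 := hr i
    have h2 := hr j
    have hs := D.sign_eq_of_mem_word (List.get_mem _ i) (List.get_mem _ j) hij
    rw [hij] at h1
    rw [h1] at h2
    simp only [smoothColours, hi, hj, if_true, Bool.false_eq_true, if_false] at h2
    rw [hij, hs]
    split_ifs with h <;> simp only [h, if_true, if_false] at h2 <;> exact h2
  · intro h
    refine ⟨fun x => if hx : ∃ i, (D.word.get i).isOver = true ∧ (D.word.get i).crossing = x then
      (c hx.choose.castSucc, c hx.choose.succ) else default, fun k => ?_⟩
    have hover : ∀ i, (D.word.get i).isOver = true →
        (D.word.get i).crossing = (D.word.get k).crossing →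
        (if hx : ∃ i, (D.word.get i).isOver = true ∧
          (D.word.get i).crossing = (D.word.get k).crossing then
          (c hx.choose.castSucc, c hx.choose.succ) else default) = (c i.castSucc, c i.succ) := by
      intro i hi hik
      have hx : ∃ i, (D.word.get i).isOver = true ∧
          (D.word.get i).crossing = (D.word.get k).crossing := ⟨i, hi, hik⟩
      have hxi : hx.choose = i := by
        apply D.nodup_word.injective_get
        exact D.eq_of_mem_word (List.get_mem _ _) (List.get_mem _ _)
          (hx.choose_spec.2.trans hik.symm) (hx.choose_spec.1.trans hi.symm)
      rw [dif_pos hx, hxi]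
    cases ho : (D.word.get k).isOver
    · have hm := D.paired _ (List.get_mem _ k)
      obtain ⟨i, hi⟩ := List.get_of_mem hm
      rw [ho] at hi
      refine (hover i (by rw [hi]; rfl) (by rw [hi])).trans ?_
      have hik := h i k ⟨by rw [hi]; rfl, ho, by rw [hi]⟩
      simp only [hi] at hik
      simp only [smoothColours, ho, Bool.false_eq_true, if_false]
      split_ifs with h' <;> simp only [h', if_true, if_false] at hik <;> exact hik
    · refine (hover k ho rfl).trans ?_
      rw [smoothColours, if_pos ho]

/-- The trace is a sum over colourings of the arcs. A colouring determines the labels of the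
crossings, and compatible labels exist exactly when it is constant on closed curves; such colourings
are functions on the set of curves. -/
theorem GaussDiagram.colouringSum_eq (D : GaussDiagram) (S : Finset ℕ) :
    colouringSum K R S D.word = (Fintype.card K : R) ^ D.loops S := by
  classical
  have hcard : (Fintype.card K) ^ D.loops S = Fintype.card {c : Fin (D.word.length + 1) → K //
      ∀ a b, D.StateJoined S a b → c a = c b} := by
    have e : (Quot (D.StateJoined S) → K) ≃ {c : Fin (D.word.length + 1) → K //
        ∀ a b, D.StateJoined S a b → c a = c b} :=
      { toFun := fun f => ⟨fun a => f (Quot.mk _ a), fun a b h => congrArg f (Quot.sound h)⟩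
        invFun := fun c => Quot.lift c.1 c.2
        left_inv := fun f => by funext q; induction q using Quot.ind; rfl
        right_inv := fun c => rfl }
    rw [← Nat.card_eq_fintype_card (α := {c : Fin (D.word.length + 1) → K //
        ∀ a b, D.StateJoined S a b → c a = c b}), ← Nat.card_congr e, Nat.card_fun,
        Nat.card_eq_fintype_card]
    rfl
  have hsum : ∀ c : Fin (D.word.length + 1) → K, (sumOver (overList D.word) fun r : ℕ → K × K =>
      if c 0 = c (Fin.last _) ∧ ∀ i, r (D.word.get i).crossing =
        smoothColours S (D.word.get i) (c i.castSucc) (c i.succ) then (1 : R) else 0) =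
      if ∀ a b, D.StateJoined S a b → c a = c b then 1 else 0 := by
    intro c
    rw [if_congr ((D.colouring_iff S c).trans
      (and_congr_right' (D.exists_smoothColours_iff S c).symm)) rfl rfl]
    by_cases h0 : c 0 = c (Fin.last _)
    · by_cases hr : ∃ r : ℕ → K × K, ∀ i, r (D.word.get i).crossing =
        smoothColours S (D.word.get i) (c i.castSucc) (c i.succ)
      · obtain ⟨g, hg⟩ := hr
        rw [if_pos ⟨h0, g, hg⟩, sumOver_eq_single (NodupLetters.overList D.nodup) g, if_pos ⟨h0, hg⟩]
        · intro r r' hrr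
          have : ∀ i, r (D.word.get i).crossing = r' (D.word.get i).crossing := fun i =>
            hrr _ (D.mem_overList (List.get_mem _ _))
          simp only [this]
        · intro r x hx hne
          rw [if_neg]
          rintro ⟨-, hr⟩
          rw [← List.mem_toFinset, D.toFinset_overList, GaussDiagram.crossings, List.mem_toFinset,
            List.mem_map] at hx
          obtain ⟨l, hl, rfl⟩ := hx
          obtain ⟨i, rfl⟩ := List.get_of_mem hl
          exact hne ((hr i).trans (hg i).symm)
      · rw [if_neg (not_and_of_not_right _ hr)]
        refine (sumOver_congr (F' := fun _ => 0) fun r => ?_).trans (sumOver_zero _)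
        rw [if_neg]
        rintro ⟨-, h⟩
        exact hr ⟨r, h⟩
    · simp [h0, sumOver_zero]
  unfold colouringSum
  simp only [trace_smoothMatrix]
  rw [sumOver_sum, Finset.sum_congr rfl fun c _ => hsum c, ← Nat.cast_pow, hcard,
    Fintype.card_subtype, Finset.sum_boole]

end Colouring

/-! ### The Jones–Kauffman polynomial as a state sum -/

section Evaluation

variable {K R : Type*} [Fintype K] [DecidableEq K] [Inhabited K] [CommRing R]

theorem strandMatrix_eq_smul (A : Rˣ) (S : Finset ℕ) (l : GaussLetter) (p : K × K) :
    (strandMatrix A l.sign l.isOver (decide (l.crossing ∈ S), p) : Matrix K K R) =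
      (if l.isOver then ((writheFactor A l.sign * if l.crossing ∈ S then A else A⁻¹ : Rˣ) : R)
        else 1) • smoothMatrix S l p := by
  unfold strandMatrix smoothMatrix
  simp only [decide_eq_true_eq]
  split_ifs <;> simp

theorem prod_map_smul {α : Type*} (w : List α) (f : α → R) (M : α → Matrix K K R) :
    (w.map fun l => f l • M l).prod = (w.map f).prod • (w.map M).prod := by
  induction w with
  | nil => simp
  | cons l w ih => simp only [List.map_cons, List.prod_cons, ih, smul_mul_smul_comm]

theorem prod_map_ite {α M : Type*} [CommMonoid M] (w : List α) (o : α → Bool) (f : α → M) :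
    (w.map fun l => if o l then f l else 1).prod = ((w.filter o).map f).prod := by
  induction w with
  | nil => simp
  | cons l w ih =>
    rw [List.map_cons, List.prod_cons, ih, List.filter_cons]
    split_ifs <;> simp

theorem list_prod_map_overList {M : Type*} [CommMonoid M] (D : GaussDiagram) (f : ℕ → M) :
    ((D.word.filter fun l => l.isOver).map fun l => f l.crossing).prod =
      ∏ x ∈ D.crossings, f x := by
  rw [← D.toFinset_overList, List.prod_toFinset _ (NodupLetters.overList D.nodup), overList,
    List.map_map]
  rfl

theorem prod_writheFactor (A : Rˣ) (D : GaussDiagram) :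
    ((D.word.filter fun l => l.isOver).map fun l => writheFactor A l.sign).prod =
      (-A ^ 3) ^ (-D.writhe) := by
  unfold GaussDiagram.writhe
  induction D.word.filter fun l => l.isOver with
  | nil => simp
  | cons l w ih =>
    rw [List.map_cons, List.map_cons, List.prod_cons, List.sum_cons, neg_add, zpow_add, ih,
      writheFactor]

/-- The factor of a state in the bracket: `A` for every `A`-smoothing, `A⁻¹` for every
`B`-smoothing. -/
theorem prod_smoothing_eq_zpow {G : Type*} [CommGroup G] (A : G) {X S : Finset ℕ} (hS : S ⊆ X) :
    ∏ x ∈ X, (if x ∈ S then A else A⁻¹) = A ^ ((S.card : ℤ) - ((X \ S).card : ℤ)) := by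
  rw [Finset.prod_ite, Finset.prod_const, Finset.prod_const, Finset.filter_mem_eq_inter,
    Finset.inter_eq_right.2 hS, ← Finset.sdiff_eq_filter, zpow_sub, zpow_natCast, zpow_natCast,
    inv_pow]

/-- The Boolean parts of the labels form a Kauffman state. With the state fixed, scalar weights
leave the trace and the colour parts count colourings of its curves. -/
theorem stateSum_eq (A : Rˣ) (D : GaussDiagram) :
    stateSum K A D.word = (((-A ^ 3) ^ (-D.writhe) : Rˣ) : R) *
      ∑ S ∈ D.crossings.powerset, ((A ^ ((S.card : ℤ) - ((D.crossings \ S).card : ℤ)) : Rˣ) : R) *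
        (Fintype.card K : R) ^ D.loops S := by
  unfold stateSum
  rw [sumOver_prod_bool (NodupLetters.overList D.nodup), D.toFinset_overList, Finset.mul_sum]
  refine Finset.sum_congr rfl fun S hS => ?_
  simp only [wordMatrix, strandMatrix_eq_smul, prod_map_smul, Matrix.trace_smul, smul_eq_mul]
  rw [← mul_sumOver, ← prod_smoothing_eq_zpow A (Finset.mem_powerset.1 hS),
    ← D.colouringSum_eq S (K := K), ← mul_assoc, ← Units.val_mul, colouringSum]
  congr 1
  rw [prod_map_ite, ← prod_writheFactor, ← list_prod_map_overList, ← List.prod_map_mul,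
    ← Units.coeHom_apply, map_list_prod, List.map_map]
  rfl

theorem GaussDiagram.loops_pos (D : GaussDiagram) (S : Finset ℕ) : 0 < D.loops S := by
  have : Nonempty (Quot (D.StateJoined S)) := ⟨Quot.mk _ 0⟩
  exact Nat.card_pos

theorem coe_negOnePow (R : Type*) [CommRing R] (k : ℤ) :
    (((k.negOnePow : ℤˣ) : ℤ) : R) = (((-1) ^ k : Rˣ) : R) := by
  have h : Units.map (Int.castRingHom R : ℤ →* R) k.negOnePow = (-1) ^ k := by
    rw [Int.negOnePow_def, map_zpow]
    congr 1
    ext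
    simp
  rw [← h]
  rfl

theorem eval₂_jonesKauffman (A : Rˣ) (D : GaussDiagram) :
    LaurentPolynomial.eval₂ (Int.castRingHom R) A D.jonesKauffman =
      (((-A ^ 3) ^ (-D.writhe) : Rˣ) : R) *
      ∑ S ∈ D.crossings.powerset, ((A ^ ((S.card : ℤ) - ((D.crossings \ S).card : ℤ)) : Rˣ) : R) *
        (-(A : R) ^ 2 - ((A⁻¹ : Rˣ) : R) ^ 2) ^ (D.loops S - 1) := by
  unfold GaussDiagram.jonesKauffman GaussDiagram.bracket
  simp only [map_mul, map_sum, map_pow, map_sub, map_neg, LaurentPolynomial.eval₂_T,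
    LaurentPolynomial.eval₂_C]
  rw [eq_intCast, coe_negOnePow, ← Units.val_mul]
  congr 2
  · rw [neg_eq_neg_one_mul (A ^ 3), mul_zpow, ← zpow_natCast, ← zpow_mul]
    congr 1
    · rw [zpow_neg, ← inv_zpow]
      simp
    · simp

/-- The factor `Fintype.card K` restores the one curve that the normalization of the bracket omits;
every state has at least one curve. -/
theorem eval₂_jonesKauffman_mul_card (A : Rˣ)
    (hd : (Fintype.card K : R) = -(A : R) ^ 2 - ((A⁻¹ : Rˣ) : R) ^ 2) (D : GaussDiagram) :
    LaurentPolynomial.eval₂ (Int.castRingHom R) A D.jonesKauffman * Fintype.card K =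
      stateSum K A D.word := by
  rw [eval₂_jonesKauffman, stateSum_eq, ← hd, mul_assoc, Finset.sum_mul]
  congr 1
  refine Finset.sum_congr rfl fun S _ => ?_
  rw [mul_assoc, ← pow_succ, Nat.sub_add_cancel (D.loops_pos S)]

end Evaluation

/-! ### Invariance of the Jones–Kauffman polynomial -/

/-- Here `A^2` must be a root of `z^2 + d z + 1`: the first square root is that of the discriminant,
the second extracts `A`. The root is nonzero because the constant term is 1. -/
theorem exists_unit_neg_sq_sub_sq (d : ℂ) : ∃ A : ℂˣ, d = -(A : ℂ) ^ 2 - ((A⁻¹ : ℂˣ) : ℂ) ^ 2 := by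
  obtain ⟨s, hs⟩ := IsAlgClosed.exists_pow_nat_eq (d ^ 2 - 4) (n := 2) (by norm_num)
  obtain ⟨a, ha⟩ := IsAlgClosed.exists_pow_nat_eq ((-d + s) / 2) (n := 2) (by norm_num)
  have hz : a ^ 2 * (a ^ 2 + d) = -1 := by
    rw [ha]
    linear_combination hs / 4
  have ha0 : a ≠ 0 := by
    rintro rfl
    norm_num at hz
  refine ⟨Units.mk0 a ha0, ?_⟩
  simp only [Units.val_mk0, Units.val_inv_eq_inv_val, inv_pow]
  field_simp
  linear_combination hz

/-- Integral Laurent polynomials agree if they agree at all `A` for which `-A ^ 2 - A ^ (-2)` is a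
positive integer. -/
theorem LaurentPolynomial.ext_of_eval {f g : LaurentPolynomial ℤ}
    (h : ∀ (d : ℕ) (A : ℂˣ), ((d + 1 : ℕ) : ℂ) = -(A : ℂ) ^ 2 - ((A⁻¹ : ℂˣ) : ℂ) ^ 2 →
      LaurentPolynomial.eval₂ (Int.castRingHom ℂ) A f =
        LaurentPolynomial.eval₂ (Int.castRingHom ℂ) A g) : f = g := by
  choose A hA using fun d : ℕ => exists_unit_neg_sq_sub_sq ((d + 1 : ℕ) : ℂ)
  -- `A d` determines `d`, so these are infinitely many points.
  have hinj : Function.Injective fun d => (A d : ℂ) := by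
    intro d d' hdd
    have := Units.ext hdd
    have h1 := hA d
    rw [this, ← hA d'] at h1
    exact Nat.succ_injective (Nat.cast_injective h1)
  obtain ⟨n, p, hp⟩ := LaurentPolynomial.exists_T_pow (f - g)
  have hroot : ∀ d, (p.map (Int.castRingHom ℂ)).IsRoot (A d : ℂ) := by
    intro d
    rw [Polynomial.IsRoot, Polynomial.eval_map, ← LaurentPolynomial.eval₂_toLaurent, hp, map_mul,
      map_sub, h d (A d) (hA d), sub_self, zero_mul]
  have hp0 : p.map (Int.castRingHom ℂ) = 0 :=
    Polynomial.eq_zero_of_infinite_isRoot _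
      ((Set.infinite_range_of_injective hinj).mono (by rintro _ ⟨d, rfl⟩; exact hroot d))
  rw [Polynomial.map_eq_zero_iff (Int.castRingHom ℂ).injective_int] at hp0
  rw [hp0, map_zero] at hp
  rw [← sub_eq_zero]
  calc f - g = (f - g) * LaurentPolynomial.T n * LaurentPolynomial.T (-n) := by
        rw [mul_assoc, ← LaurentPolynomial.T_add]; simp
    _ = 0 := by rw [← hp, zero_mul]

theorem jonesKauffman_eq_of_stateSum {D D' : GaussDiagram}
    (h : ∀ (d : ℕ) (A : ℂˣ), ((d + 1 : ℕ) : ℂ) = -(A : ℂ) ^ 2 - ((A⁻¹ : ℂˣ) : ℂ) ^ 2 →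
      (stateSum (Fin (d + 1)) A D.word : ℂ) = stateSum (Fin (d + 1)) A D'.word) :
    D.jonesKauffman = D'.jonesKauffman := by
  refine LaurentPolynomial.ext_of_eval fun d A hA => ?_
  have hA' : (Fintype.card (Fin (d + 1)) : ℂ) = -(A : ℂ) ^ 2 - ((A⁻¹ : ℂˣ) : ℂ) ^ 2 := by
    simpa using hA
  have h1 := eval₂_jonesKauffman_mul_card A hA' D
  have h2 := eval₂_jonesKauffman_mul_card A hA' D'
  rw [h d A hA, ← h2] at h1
  refine mul_right_cancel₀ ?_ h1
  rw [Fintype.card_fin]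
  exact Nat.cast_ne_zero.2 (Nat.succ_ne_zero d)

/-- The Jones–Kauffman polynomial is invariant under virtual isotopy. -/
theorem jonesKauffman_eq_of_gaussMove {D D' : GaussDiagram} (h : GaussMove D.word D'.word) :
    D.jonesKauffman = D'.jonesKauffman := by
  refine jonesKauffman_eq_of_stateSum fun d A hA => ?_
  exact stateSum_eq_of_gaussMove A (by simpa using hA) h D.nodup

/-- The Birman coefficients as invariants of virtual knots. -/
noncomputable def VirtualKnot.birmanCoeff (n : ℕ) : VirtualKnot → ℚ :=
  Quot.lift (GaussDiagram.birmanCoeff n) fun D D' h => by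
    unfold GaussDiagram.birmanCoeff
    rw [jonesKauffman_eq_of_gaussMove h]

theorem VirtualKnot.birmanCoeff_toKnot (n : ℕ) (D : GaussDiagram) :
    VirtualKnot.birmanCoeff n D.toKnot = D.birmanCoeff n := rfl

/-! ### Reversal of arrows -/

namespace GaussDiagram

theorem crossings_reverse (e : ℤˣ) (D : GaussDiagram) (T : Finset ℕ) :
    (D.reverse e T).crossings = D.crossings := by
  unfold crossings reverse
  rw [List.map_map]
  congr 1
  refine List.map_congr_left fun l _ => ?_
  by_cases h : l.crossing ∈ T <;> simp [h]

/-- The crossings in `T` exchange their smoothings when the sign is changed. -/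
theorem loops_reverse (e : ℤˣ) (D : GaussDiagram) (T S S' : Finset ℕ)
    (hS : ∀ x ∈ D.crossings, (x ∈ S' ↔ x ∈ S) ↔ (x ∈ T → e = 1)) :
    (D.reverse e T).loops S' = D.loops S := by
  classical
  have hc : ∀ l ∈ D.word, l.crossing ∈ D.crossings := fun l hl => by
    rw [crossings, List.mem_toFinset]; exact List.mem_map_of_mem hl
  -- Two colours suffice: the number of colourings is a power of 2 whose exponent is the number of
  -- curves.
  have key : colouringSum (Fin 2) ℚ S' (D.reverse e T).word = colouringSum (Fin 2) ℚ S D.word := by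
    have hperm : (overList (D.reverse e T).word).Perm (overList D.word) := by
      refine List.perm_of_nodup_nodup_toFinset_eq (NodupLetters.overList (D.reverse e T).nodup)
        (NodupLetters.overList D.nodup) ?_
      rw [toFinset_overList, toFinset_overList, crossings_reverse]
    unfold colouringSum
    rw [sumOver_perm hperm (NodupLetters.overList (D.reverse e T).nodup)]
    -- `O` consists of the crossings smoothed along the orientation; it is the same before and
    -- after, since sign and smoothing change together. At such a crossing the strands carry
    -- opposite orders of the label, so reversing the arrow amounts to exchanging the two colours.
    -- At the others both strands carry the same order.
    obtain ⟨O, hlO⟩ : ∃ O : Set ℕ, ∀ l ∈ D.word,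
        (l.crossing ∈ O ↔ (l.crossing ∈ S ↔ l.sign = 1)) := by
      refine ⟨{x | ∃ l ∈ D.word, l.crossing = x ∧ (x ∈ S ↔ l.sign = 1)}, fun l hl => ?_⟩
      constructor
      · rintro ⟨l', hl', hc', h⟩
        rw [D.sign_eq_of_mem_word hl hl' hc'.symm]
        exact h
      · exact fun h => ⟨l, hl, rfl, h⟩
    refine Eq.trans ?_ (sumOver_relabel (NodupLetters.overList D.nodup)
      (fun x => if x ∈ O ∧ x ∈ T then Equiv.prodComm (Fin 2) (Fin 2) else Equiv.refl _) ?_)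
    · refine sumOver_congr fun r => ?_
      unfold reverse
      rw [List.map_map]
      congr 2
      refine List.map_congr_left fun l hl => ?_
      have h1 := hlO l hl
      have h2 := hS _ (hc l hl)
      obtain ⟨x, o, s⟩ := l
      simp only at h1 h2
      clear hlO hS hl hc hperm
      have hne : ¬(-1 : ℤˣ) = 1 := by decide
      have hne' : ¬(1 : ℤˣ) = -1 := by decide
      simp only [Function.comp_apply, smoothMatrix]
      by_cases hT : x ∈ T
      · rcases Int.units_eq_one_or e with rfl | rfl <;> rcases Int.units_eq_one_or s with rfl | rfl <;>
        by_cases hxS : x ∈ S <;> cases o <;> simp_all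
      · by_cases hxS : x ∈ S <;> simp_all
    · intro r r' h
      refine congrArg (fun L : List (Matrix (Fin 2) (Fin 2) ℚ) => L.prod.trace)
        (List.map_congr_left fun l hl => ?_)
      rw [h _ (D.mem_overList hl)]
  rw [colouringSum_eq, colouringSum_eq] at key
  have key' : (2 : ℕ) ^ (D.reverse e T).loops S' = 2 ^ D.loops S := by
    simpa using (by exact_mod_cast key : ((2 : ℕ) : ℚ) ^ (D.reverse e T).loops S' = 2 ^ D.loops S)
  exact Nat.pow_right_injective le_rfl key'

end GaussDiagram

/-! ### Signs and writhe under reversal of arrows; virtualization -/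

namespace GaussDiagram

theorem writhe_eq_sum (D : GaussDiagram) (f : ℕ → ℤ) (hf : ∀ l ∈ D.word, (l.sign : ℤ) = f l.crossing) :
    D.writhe = ∑ x ∈ D.crossings, f x := by
  rw [← D.toFinset_overList, List.sum_toFinset _ (NodupLetters.overList D.nodup), overList,
    List.map_map, writhe]
  congr 1
  exact List.map_congr_left fun l hl => hf l (List.mem_of_mem_filter hl)

/-- The sign of a crossing. -/
noncomputable def signOf (D : GaussDiagram) (x : ℕ) : ℤˣ := if x ∈ D.positiveCrossings then 1 else -1

theorem sign_eq_signOf (D : GaussDiagram) {l : GaussLetter} (hl : l ∈ D.word) :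
    l.sign = D.signOf l.crossing := by
  have hpos : l.crossing ∈ D.positiveCrossings ↔
      ∃ l' ∈ D.word, l'.sign = 1 ∧ l'.crossing = l.crossing := by
    simp [positiveCrossings, and_assoc]
  unfold signOf
  split_ifs with h <;> rw [hpos] at h
  · obtain ⟨l', hl', hs, hc⟩ := h
    rw [← D.sign_eq_of_mem_word hl' hl hc, hs]
  · exact (Int.units_eq_one_or l.sign).resolve_left fun hs => h ⟨l, hl, hs, rfl⟩

theorem writhe_eq_sum_signOf (D : GaussDiagram) :
    D.writhe = ∑ x ∈ D.crossings, (D.signOf x : ℤ) :=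
  D.writhe_eq_sum _ fun l hl => by rw [D.sign_eq_signOf hl]

theorem writhe_reverse (e : ℤˣ) (D : GaussDiagram) (T : Finset ℕ) :
    (D.reverse e T).writhe = ∑ x ∈ D.crossings, ((if x ∈ T then e * D.signOf x else D.signOf x : ℤˣ) : ℤ) := by
  rw [← crossings_reverse e D T]
  refine writhe_eq_sum _ _ fun l hl => ?_
  obtain ⟨l', hl', rfl⟩ := List.mem_map.1 hl
  by_cases h : l'.crossing ∈ T <;> simp [h, D.sign_eq_signOf hl']

theorem positiveCrossings_subset (D : GaussDiagram) : D.positiveCrossings ⊆ D.crossings := by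
  intro x hx
  simp only [positiveCrossings, crossings, List.mem_toFinset, List.mem_map, List.mem_filter] at hx ⊢
  obtain ⟨l, hl, rfl⟩ := hx
  exact ⟨l, hl.1, rfl⟩

theorem writhe_switch (D : GaussDiagram) {T : Finset ℕ} (hT : T ⊆ D.positiveCrossings) :
    (D.switch T).writhe = D.writhe - 2 * T.card := by
  rw [switch, writhe_reverse, writhe_eq_sum_signOf]
  have h : ∀ x ∈ D.crossings, ((if x ∈ T then -1 * D.signOf x else D.signOf x : ℤˣ) : ℤ) =
      D.signOf x - if x ∈ T then 2 else 0 := by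
    intro x _
    split_ifs with hx
    · simp [signOf, hT hx]
    · simp
  rw [Finset.sum_congr rfl h, Finset.sum_sub_distrib, Finset.sum_ite_mem,
    Finset.inter_eq_right.2 (hT.trans D.positiveCrossings_subset)]
  simp [mul_comm]

/-- The Jones–Kauffman polynomial is invariant under the virtualization move. -/
theorem jonesKauffman_virtualize (D : GaussDiagram) (c : ℕ) :
    (D.virtualize c).jonesKauffman = D.jonesKauffman := by
  have hw : (D.virtualize c).writhe = D.writhe := by
    rw [virtualize, writhe_reverse, writhe_eq_sum_signOf]
    simp
  have hl : ∀ S, (D.virtualize c).loops S = D.loops S := fun S =>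
    loops_reverse 1 D {c} S S (by simp)
  have hc : (D.virtualize c).crossings = D.crossings := crossings_reverse 1 D {c}
  simp only [jonesKauffman, bracket, hw, hl, hc]

end GaussDiagram

/-! ### Kauffman finite type -/

section FiniteType

variable {R : Type*} [CommRing R]

/-- The state `symmDiff S T` of the switched diagram has as many curves as the state `S` of `D`;
reindexing by it makes the loop factor independent of `T`. The power `A^(6 |T|)` comes from the
writhe, which drops by `2 |T|`. -/
theorem eval₂_jonesKauffman_switch (A : Rˣ) (D : GaussDiagram) {T : Finset ℕ}
    (hT : T ⊆ D.positiveCrossings) :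
    LaurentPolynomial.eval₂ (Int.castRingHom R) A (D.switch T).jonesKauffman =
      ∑ S ∈ D.crossings.powerset, ((((-A ^ 3) ^ (-D.writhe) : Rˣ) : R) *
        (-(A : R) ^ 2 - ((A⁻¹ : Rˣ) : R) ^ 2) ^ (D.loops S - 1)) *
        ((A ^ (6 * T.card) * ∏ x ∈ D.crossings, if x ∈ symmDiff S T then A else A⁻¹ : Rˣ) : R) := by
  have hTX := hT.trans D.positiveCrossings_subset
  have hc : (D.switch T).crossings = D.crossings := D.crossings_reverse (-1) T
  rw [eval₂_jonesKauffman, hc, Finset.mul_sum]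
  have hbij : ∀ S ∈ D.crossings.powerset, symmDiff S T ∈ D.crossings.powerset := by
    intro S hS
    rw [Finset.mem_powerset] at hS ⊢
    exact symmDiff_le_sup.trans (Finset.union_subset hS hTX)
  refine (Finset.sum_nbij' (fun S => symmDiff S T) (fun S => symmDiff S T) hbij hbij
    (fun S _ => by simp) (fun S _ => by simp) fun S hS => ?_).symm
  have hl : (D.switch T).loops (symmDiff S T) = D.loops S := by
    refine D.loops_reverse (-1) T S _ fun x _ => ?_
    have hne : ¬(-1 : ℤˣ) = 1 := by decide
    by_cases h1 : x ∈ S <;> by_cases h2 : x ∈ T <;> simp [Finset.mem_symmDiff, h1, h2, hne]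
  have hw : (-A ^ 3) ^ (-(D.switch T).writhe) = (-A ^ 3) ^ (-D.writhe) * A ^ (6 * T.card) := by
    rw [D.writhe_switch hT, neg_sub, sub_eq_add_neg, add_comm, zpow_add]
    congr 1
    rw [show (2 * (T.card : ℤ)) = ((2 * T.card : ℕ) : ℤ) by push_cast; ring, zpow_natCast, pow_mul,
      pow_mul]
    congr 1
    rw [neg_sq, ← pow_mul]
  rw [hl, hw, ← prod_smoothing_eq_zpow A (Finset.mem_powerset.1 (hbij S hS))]
  simp only [Units.val_mul]
  ring

/-- The weight is a product over crossings, so the alternating sum is the expansion of a product of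
differences, one for each vertex. -/
theorem sum_alternating_smoothing (A : Rˣ) {X V : Finset ℕ} (hV : V ⊆ X) (S : Finset ℕ) :
    ∑ T ∈ V.powerset, (-1 : R) ^ T.card *
        ((A ^ (6 * T.card) * ∏ x ∈ X, if x ∈ symmDiff S T then A else A⁻¹ : Rˣ) : R) =
      (∏ x ∈ X \ V, ((if x ∈ S then A else A⁻¹ : Rˣ) : R)) *
        ∏ x ∈ V, (((if x ∈ S then A else A⁻¹ : Rˣ) : R) -
          ((A ^ 6 * if x ∈ S then A⁻¹ else A : Rˣ) : R)) := by
  rw [Finset.prod_sub, Finset.mul_sum]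
  refine Finset.sum_congr rfl fun T hT => ?_
  rw [Finset.mem_powerset] at hT
  have hX : ∀ x ∈ X \ V, (if x ∈ symmDiff S T then A else A⁻¹) = if x ∈ S then A else A⁻¹ := by
    intro x hx
    have hxT : x ∉ T := fun h => (Finset.mem_sdiff.1 hx).2 (hT h)
    simp [Finset.mem_symmDiff, hxT]
  have hV' : ∀ x ∈ V \ T, (if x ∈ symmDiff S T then A else A⁻¹) = if x ∈ S then A else A⁻¹ := by
    intro x hx
    simp [Finset.mem_symmDiff, (Finset.mem_sdiff.1 hx).2]
  have hT' : ∀ x ∈ T, (if x ∈ symmDiff S T then A else A⁻¹) = if x ∈ S then A⁻¹ else A := by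
    intro x hx
    by_cases h : x ∈ S <;> simp [Finset.mem_symmDiff, hx, h]
  rw [← Finset.prod_sdiff hV, ← Finset.prod_sdiff hT, Finset.prod_congr rfl hX,
    Finset.prod_congr rfl hV', Finset.prod_congr rfl hT']
  simp only [Units.val_mul, Units.coe_prod, Finset.prod_mul_distrib, Finset.prod_const, pow_mul,
    Units.val_pow_eq_pow_val]
  ring

theorem X_dvd_smoothing_sub (b : Prop) [Decidable b] :
    (PowerSeries.X : PowerSeries ℚ) ∣ ((if b then expUnit else expUnit⁻¹ : (PowerSeries ℚ)ˣ) : PowerSeries ℚ) -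
      ((expUnit ^ 6 * if b then expUnit⁻¹ else expUnit : (PowerSeries ℚ)ˣ) : PowerSeries ℚ) := by
  have h1 : PowerSeries.constantCoeff (expUnit : PowerSeries ℚ) = 1 := by
    change PowerSeries.constantCoeff (PowerSeries.exp ℚ) = 1
    simp
  have h2 : PowerSeries.constantCoeff ((expUnit⁻¹ : (PowerSeries ℚ)ˣ) : PowerSeries ℚ) = 1 := by
    have := congrArg PowerSeries.constantCoeff expUnit.mul_inv
    rwa [map_mul, h1, one_mul, map_one] at this
  rw [PowerSeries.X_dvd_iff]
  split_ifs <;> simp only [map_sub, Units.val_mul, map_mul, Units.val_pow_eq_pow_val, map_pow, h1,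
    h2] <;> norm_num

theorem isKauffmanFiniteType_birmanCoeff (n : ℕ) :
    IsKauffmanFiniteType n (VirtualKnot.birmanCoeff n) := by
  intro D V hV hn
  have hVX := hV.trans D.positiveCrossings_subset
  have key : kauffmanExtension (VirtualKnot.birmanCoeff n) D V = PowerSeries.coeff n
      (∑ T ∈ V.powerset, (-1 : PowerSeries ℚ) ^ T.card *
        LaurentPolynomial.eval₂ (Int.castRingHom (PowerSeries ℚ)) expUnit
          (D.switch T).jonesKauffman) := by
    rw [kauffmanExtension, map_sum]
    refine Finset.sum_congr rfl fun T _ => ?_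
    rw [VirtualKnot.birmanCoeff_toKnot, GaussDiagram.birmanCoeff]
    rcases Nat.even_or_odd T.card with h | h <;> simp [h]
  rw [key]
  refine PowerSeries.X_pow_dvd_iff.1 ?_ n hn
  rw [Finset.sum_congr rfl fun T hT => by
    rw [eval₂_jonesKauffman_switch expUnit D ((Finset.mem_powerset.1 hT).trans hV), Finset.mul_sum]]
  rw [Finset.sum_comm]
  refine Finset.dvd_sum fun S _ => ?_
  simp only [mul_left_comm ((-1 : PowerSeries ℚ) ^ _)]
  rw [← Finset.mul_sum, sum_alternating_smoothing _ hVX]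
  refine Dvd.dvd.mul_left (Dvd.dvd.mul_left ?_ _) _
  rw [← Finset.prod_const]
  exact Finset.prod_dvd_prod_of_dvd _ _ fun x _ => X_dvd_smoothing_sub _

end FiniteType

/-! ### Parallel twists -/

/-- The Gauss diagram with parallel positive arrows: all overpasses, then all underpasses, in the
order of the list. -/
def parallelTwist (L : List ℕ) (hL : L.Nodup) : GaussDiagram where
  word := (L.map fun x => ⟨x, true, 1⟩) ++ L.map fun x => ⟨x, false, 1⟩
  nodup := by
    rw [List.map_append, List.map_map, List.map_map]
    refine List.Nodup.append (hL.map fun x y h => (Prod.ext_iff.1 h).1)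
      (hL.map fun x y h => (Prod.ext_iff.1 h).1) ?_
    intro q h1 h2
    obtain ⟨x, -, rfl⟩ := List.mem_map.1 h1
    obtain ⟨y, -, h⟩ := List.mem_map.1 h2
    simp at h
  paired := by
    intro l hl
    simp only [List.mem_append, List.mem_map] at hl ⊢
    rcases hl with ⟨x, hx, rfl⟩ | ⟨x, hx, rfl⟩
    · exact Or.inr ⟨x, hx, rfl⟩
    · exact Or.inl ⟨x, hx, rfl⟩

/-- The family is closed under deletion, so its semivirtual alternating sums depend only on numbers
of arrows. -/
theorem parallelTwist_delete (L : List ℕ) (hL : L.Nodup) (T : Finset ℕ) :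
    (parallelTwist L hL).delete T = parallelTwist (L.filter fun x => x ∉ T) (hL.filter _) := by
  ext1
  simp [parallelTwist, GaussDiagram.delete, List.filter_map, Function.comp_def]

theorem crossings_parallelTwist (L : List ℕ) (hL : L.Nodup) :
    (parallelTwist L hL).crossings = L.toFinset := by
  ext x
  simp [parallelTwist, GaussDiagram.crossings]

theorem overList_parallelTwist (L : List ℕ) (hL : L.Nodup) :
    overList (parallelTwist L hL).word = L := by
  simp [parallelTwist, overList, List.filter_map, Function.comp_def]

section StateSum

variable {K R : Type*} [Fintype K] [DecidableEq K] [CommRing R]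

theorem trace_mul_single (Y : Matrix K K R) (i j : K) (c : R) :
    (Y * Matrix.single i j c).trace = Y j i * c := by
  rw [Matrix.trace_mul_single]
  simp

/-- This and the next five identities give the effect of one more arrow on the three closures
`tr(YZ)`, `tr Y * tr Z` and `tr(Y Zᵀ)`. The oriented smoothing exchanges the first two and fixes the
third. The other smoothing sends all three to the third, with an additional closed curve if it
starts there. -/
theorem sum_trace_single_swap (Y Z : Matrix K K R) :
    ∑ p : K × K, (Y * Matrix.single p.1 p.2 (1 : R) * (Z * Matrix.single p.2 p.1 (1 : R))).trace =
      Y.trace * Z.trace := by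
  simp only [← Matrix.mul_assoc, trace_mul_single]
  rw [Fintype.sum_prod_type, Matrix.trace, Matrix.trace, Finset.sum_mul_sum]
  refine Finset.sum_congr rfl fun i _ => Finset.sum_congr rfl fun j _ => ?_
  simp [Matrix.mul_apply, Matrix.single_apply, ite_and]

theorem sum_trace_single (Y Z : Matrix K K R) :
    ∑ p : K × K, (Y * Matrix.single p.1 p.2 (1 : R) * (Z * Matrix.single p.1 p.2 (1 : R))).trace =
      (Y * Z.transpose).trace := by
  simp only [← Matrix.mul_assoc, trace_mul_single]
  rw [Fintype.sum_prod_type, Finset.sum_comm, Matrix.trace]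
  refine Finset.sum_congr rfl fun i _ => ?_
  rw [Matrix.diag, Matrix.mul_apply]
  refine Finset.sum_congr rfl fun j _ => ?_
  simp [Matrix.mul_apply, Matrix.single_apply, ite_and]

theorem sum_trace_mul_trace_swap (Y Z : Matrix K K R) :
    ∑ p : K × K, (Y * Matrix.single p.1 p.2 (1 : R)).trace * (Z * Matrix.single p.2 p.1 (1 : R)).trace =
      (Y * Z).trace := by
  simp only [trace_mul_single, mul_one]
  rw [Fintype.sum_prod_type, Finset.sum_comm]
  rfl

theorem sum_trace_mul_trace (Y Z : Matrix K K R) :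
    ∑ p : K × K, (Y * Matrix.single p.1 p.2 (1 : R)).trace * (Z * Matrix.single p.1 p.2 (1 : R)).trace =
      (Y * Z.transpose).trace := by
  simp only [trace_mul_single, mul_one]
  rw [Fintype.sum_prod_type, Finset.sum_comm]
  rfl

theorem sum_trace_transpose_swap (Y Z : Matrix K K R) :
    ∑ p : K × K, (Y * Matrix.single p.1 p.2 (1 : R) * (Z * Matrix.single p.2 p.1 (1 : R)).transpose).trace =
      (Y * Z.transpose).trace := by
  have h : ∑ p : K × K, (Matrix.single p.1 p.2 (1 : R) * Matrix.single p.1 p.2 (1 : R) : Matrix K K R) = 1 := by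
    ext i j
    simp [Matrix.sum_apply, Fintype.sum_prod_type, Matrix.mul_apply, Matrix.single_apply, ite_and,
      Matrix.one_apply, eq_comm]
  rw [← Matrix.trace_sum]
  simp only [Matrix.transpose_mul, Matrix.transpose_single]
  simp only [Matrix.mul_assoc]
  simp only [← Matrix.mul_assoc (Matrix.single _ _ _)]
  rw [← Finset.mul_sum, ← Finset.sum_mul, h, one_mul]

theorem sum_trace_transpose (Y Z : Matrix K K R) :
    ∑ p : K × K, (Y * Matrix.single p.1 p.2 (1 : R) * (Z * Matrix.single p.1 p.2 (1 : R)).transpose).trace =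
      Fintype.card K * (Y * Z.transpose).trace := by
  have h : ∑ p : K × K, (Matrix.single p.1 p.2 (1 : R) * Matrix.single p.2 p.1 (1 : R) : Matrix K K R) =
      (Fintype.card K : R) • 1 := by
    ext i j
    simp only [Matrix.sum_apply, Fintype.sum_prod_type, Matrix.single_mul_single_same, mul_one,
      Matrix.single_apply, ite_and, Matrix.smul_apply, Matrix.one_apply]
    by_cases h : i = j <;> simp [h]
  rw [← Matrix.trace_sum]
  simp only [Matrix.transpose_mul, Matrix.transpose_single]
  simp only [Matrix.mul_assoc]
  simp only [← Matrix.mul_assoc (Matrix.single _ _ _)]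
  rw [← Finset.mul_sum, ← Finset.sum_mul, h, Matrix.smul_mul, one_mul, Matrix.mul_smul,
    Matrix.trace_smul, smul_eq_mul]

variable [Inhabited K]

/-- Iterating these rules, only oriented smoothings give `a^n` times a closure that alternates with
the parity. The coefficient `C n` of `tr(Y Zᵀ)` satisfies `C (n+1) = (a + b d) * C n + b * a^n`; the
factor `Fintype.card K` avoids dividing by `d` in its solution. -/
theorem sumOver_parallelTwist (A : Rˣ) {a b : R} (ha : a = writheFactor A 1 * A)
    (hb : b = writheFactor A 1 * ((A⁻¹ : Rˣ) : R)) {L : List ℕ} (hL : L.Nodup)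
    (Y Z : Matrix K K R) :
    Fintype.card K * sumOver L (fun ω : ℕ → Bool × K × K =>
      (Y * (L.map fun x => strandMatrix A 1 true (ω x)).prod *
        (Z * (L.map fun x => strandMatrix A 1 false (ω x)).prod)).trace) =
      Fintype.card K * (a ^ L.length *
        if Even L.length then (Y * Z).trace else Y.trace * Z.trace) +
      ((a + b * Fintype.card K) ^ L.length - a ^ L.length) * (Y * Z.transpose).trace := by
  induction L generalizing Y Z with
  | nil => simp [sumOver]
  | cons x L ih =>
    obtain ⟨hx, hL⟩ := List.nodup_cons.1 hL
    have hmap : ∀ (o : Bool) (ω : ℕ → Bool × K × K) (p : Bool × K × K),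
        (L.map fun y => strandMatrix A 1 o (Function.update ω x p y)) =
          L.map fun y => strandMatrix A 1 o (ω y) := by
      intro o ω p
      refine List.map_congr_left fun y hy => ?_
      rw [Function.update_of_ne]
      rintro rfl
      exact hx hy
    simp only [sumOver_cons, List.map_cons, List.prod_cons, hmap, Function.update_self,
      ← Matrix.mul_assoc _ (strandMatrix _ _ _ _)]
    rw [Finset.mul_sum]
    simp only [ih hL]
    have ht : ∀ p : K × K, (strandMatrix A 1 true (true, p) : Matrix K K R) =
        a • Matrix.single p.1 p.2 1 := by
      intro p; simp [strandMatrix, ha]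
    have hf : ∀ p : K × K, (strandMatrix A 1 true (false, p) : Matrix K K R) =
        b • Matrix.single p.1 p.2 1 := by
      intro p; simp [strandMatrix, hb]
    have ht' : ∀ p : K × K, (strandMatrix A 1 false (true, p) : Matrix K K R) =
        Matrix.single p.2 p.1 1 := by
      intro p; simp [strandMatrix]
    have hf' : ∀ p : K × K, (strandMatrix A 1 false (false, p) : Matrix K K R) =
        Matrix.single p.1 p.2 1 := by
      intro p; simp [strandMatrix]
    rw [Fintype.sum_prod_type, Fintype.sum_bool]
    simp only [ht, hf, ht', hf', Matrix.mul_smul, Matrix.smul_mul, Matrix.trace_smul, smul_eq_mul,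
      Finset.sum_add_distrib, ← Finset.mul_sum, sum_trace_transpose, sum_trace_transpose_swap,
      List.length_cons, Nat.even_add_one]
    by_cases he : Even L.length
    · simp only [he, if_true, not_true, if_false, ← Finset.mul_sum, sum_trace_single_swap,
        sum_trace_single]
      ring
    · simp only [he, if_true, not_false_eq_true, if_false, mul_assoc a (Matrix.trace _),
        mul_assoc b (Matrix.trace _), ← Finset.mul_sum, sum_trace_mul_trace_swap,
        sum_trace_mul_trace]
      ring

end StateSum

open LaurentPolynomial in
/-- The Jones–Kauffman polynomials of parallel twists. -/
theorem jonesKauffman_parallelTwist (L : List ℕ) (hL : L.Nodup) :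
    (-T 2 - T (-2)) * (parallelTwist L hL).jonesKauffman =
      (-T (-2)) ^ L.length * (if Even L.length then -T 2 - T (-2) else (-T 2 - T (-2)) ^ 2) +
        T (-6) ^ L.length - (-T (-2)) ^ L.length := by
  refine LaurentPolynomial.ext_of_eval fun d A hA => ?_
  have hA' : (Fintype.card (Fin (d + 1)) : ℂ) = -(A : ℂ) ^ 2 - ((A⁻¹ : ℂˣ) : ℂ) ^ 2 := by
    simpa using hA
  have hd0 : ((d + 1 : ℕ) : ℂ) ≠ 0 := Nat.cast_ne_zero.2 (Nat.succ_ne_zero d)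
  have h1 := eval₂_jonesKauffman_mul_card A hA' (parallelTwist L hL)
  have h2 := sumOver_parallelTwist (K := Fin (d + 1)) A rfl rfl hL 1 1
  simp only [one_mul, Matrix.transpose_one, mul_one, Matrix.trace_one] at h2
  have h3 : stateSum (Fin (d + 1)) A (parallelTwist L hL).word =
      sumOver L (fun ω : ℕ → Bool × Fin (d + 1) × Fin (d + 1) =>
      ((L.map fun x => strandMatrix A 1 true (ω x)).prod *
        (L.map fun x => strandMatrix A 1 false (ω x)).prod).trace) := by
    unfold stateSum
    rw [overList_parallelTwist]
    refine sumOver_congr fun ω => ?_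
    simp [wordMatrix, parallelTwist, Function.comp_def]
  rw [← h3, ← h1] at h2
  have hAi : (A : ℂ) * ((A⁻¹ : ℂˣ) : ℂ) = 1 := by simp
  have hw : ((writheFactor A 1 : ℂˣ) : ℂ) = -((A⁻¹ : ℂˣ) : ℂ) ^ 3 := by
    simp [writheFactor, ← inv_pow, inv_neg]
  simp only [hw, Fintype.card_fin] at h2
  have e2 : LaurentPolynomial.eval₂ (Int.castRingHom ℂ) A (T 2) = (A : ℂ) ^ 2 := by
    rw [LaurentPolynomial.eval₂_T]; norm_cast
  have e2' : LaurentPolynomial.eval₂ (Int.castRingHom ℂ) A (T (-2)) = ((A⁻¹ : ℂˣ) : ℂ) ^ 2 := by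
    rw [LaurentPolynomial.eval₂_T, ← Units.val_pow_eq_pow_val, inv_pow, zpow_neg]; norm_cast
  have e6' : LaurentPolynomial.eval₂ (Int.castRingHom ℂ) A (T (-6)) = ((A⁻¹ : ℂˣ) : ℂ) ^ 6 := by
    rw [LaurentPolynomial.eval₂_T, ← Units.val_pow_eq_pow_val, inv_pow, zpow_neg]; norm_cast
  simp only [map_mul, map_sub, map_add, map_pow, map_neg, apply_ite
    (LaurentPolynomial.eval₂ (Int.castRingHom ℂ) A), e2, e2', e6', ← hA]
  generalize LaurentPolynomial.eval₂ (Int.castRingHom ℂ) A (parallelTwist L hL).jonesKauffman = F at *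
  generalize ((A⁻¹ : ℂˣ) : ℂ) = B at *
  generalize (A : ℂ) = C at *
  -- With the writhe factor, an oriented smoothing weighs `-A^(-2)`, and `a + b d` equals `A^(-6)`.
  have ea : -B ^ 3 * C = -B ^ 2 := by linear_combination -B ^ 2 * hAi
  have eb : -B ^ 3 * C + -B ^ 3 * B * ((d + 1 : ℕ) : ℂ) = B ^ 6 := by
    rw [hA]
    linear_combination (-B ^ 2 + B ^ 2 * (C * B + 1)) * hAi
  rw [eb, ea] at h2
  refine mul_left_cancel₀ hd0 (mul_left_cancel₀ hd0 ?_)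
  split_ifs at h2 ⊢ <;> linear_combination ((d + 1 : ℕ) : ℂ) * h2

/-! ### Goussarov–Polyak–Viro finite type -/

theorem coe_expUnit_mul_inv :
    (expUnit : PowerSeries ℚ) * ((expUnit⁻¹ : (PowerSeries ℚ)ˣ) : PowerSeries ℚ) = 1 := by
  simp

/-- The parity condition is written through `(1 ± (-1)^ℓ) / 2`, which leaves pure exponentials in
the length; doubling clears the denominator. -/
theorem eval₂_jonesKauffman_parallelTwist (L : List ℕ) (hL : L.Nodup) {a b δ : PowerSeries ℚ}
    (ha : a = (expUnit : PowerSeries ℚ)) (hb : b = ((expUnit⁻¹ : (PowerSeries ℚ)ˣ) : PowerSeries ℚ))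
    (hδ : δ = -a ^ 2 - b ^ 2) :
    2 * δ * LaurentPolynomial.eval₂ (Int.castRingHom (PowerSeries ℚ)) expUnit
        (parallelTwist L hL).jonesKauffman =
      (δ + δ ^ 2 - 2) * (-b ^ 2) ^ L.length + (δ - δ ^ 2) * (b ^ 2) ^ L.length +
        2 * (b ^ 6) ^ L.length := by
  have h := congrArg (LaurentPolynomial.eval₂ (Int.castRingHom (PowerSeries ℚ)) expUnit)
    (jonesKauffman_parallelTwist L hL)
  have e2 : LaurentPolynomial.eval₂ (Int.castRingHom (PowerSeries ℚ)) expUnit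
      (LaurentPolynomial.T 2) = a ^ 2 := by
    rw [LaurentPolynomial.eval₂_T, ha]; norm_cast
  have e2' : LaurentPolynomial.eval₂ (Int.castRingHom (PowerSeries ℚ)) expUnit
      (LaurentPolynomial.T (-2)) = b ^ 2 := by
    rw [LaurentPolynomial.eval₂_T, hb, ← Units.val_pow_eq_pow_val, inv_pow, zpow_neg]; norm_cast
  have e6' : LaurentPolynomial.eval₂ (Int.castRingHom (PowerSeries ℚ)) expUnit
      (LaurentPolynomial.T (-6)) = b ^ 6 := by
    rw [LaurentPolynomial.eval₂_T, hb, ← Units.val_pow_eq_pow_val, inv_pow, zpow_neg]; norm_cast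
  simp only [map_mul, map_sub, map_add, map_pow, map_neg, apply_ite
    (LaurentPolynomial.eval₂ (Int.castRingHom (PowerSeries ℚ)) expUnit), e2, e2', e6', ← hδ] at h
  rw [mul_assoc, h]
  split_ifs with he
  · rw [he.neg_pow]
    ring
  · rw [(Nat.not_even_iff_odd.1 he).neg_pow]
    ring

/-- The alternating sum of the Jones–Kauffman polynomials of a parallel twist whose crossings are all
semivirtual. -/
noncomputable def semivirtualTwistSeries (k : ℕ) : PowerSeries ℚ :=
  ∑ T ∈ (Finset.range k).powerset, (-1) ^ T.card *
    LaurentPolynomial.eval₂ (Int.castRingHom (PowerSeries ℚ)) expUnit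
      ((parallelTwist (List.range k) List.nodup_range).delete T).jonesKauffman

theorem gpvExtension_parallelTwist (n k : ℕ) :
    gpvExtension (VirtualKnot.birmanCoeff n) (parallelTwist (List.range k) List.nodup_range)
      (Finset.range k) = PowerSeries.coeff n (semivirtualTwistSeries k) := by
  rw [gpvExtension, semivirtualTwistSeries, map_sum]
  refine Finset.sum_congr rfl fun T _ => ?_
  rw [VirtualKnot.birmanCoeff_toKnot, GaussDiagram.birmanCoeff]
  rcases Nat.even_or_odd T.card with h | h <;> simp [h]

/-- By the binomial theorem, the alternating sum over deleted sets turns each exponential `z^ℓ` into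
`(z - 1)^k`. -/
theorem mul_semivirtualTwistSeries (k : ℕ) {a b δ : PowerSeries ℚ}
    (ha : a = (expUnit : PowerSeries ℚ)) (hb : b = ((expUnit⁻¹ : (PowerSeries ℚ)ˣ) : PowerSeries ℚ))
    (hδ : δ = -a ^ 2 - b ^ 2) :
    2 * δ * semivirtualTwistSeries k = (δ + δ ^ 2 - 2) * (-b ^ 2 - 1) ^ k +
      (δ - δ ^ 2) * (b ^ 2 - 1) ^ k + 2 * (b ^ 6 - 1) ^ k := by
  have hs : ∀ z : PowerSeries ℚ, ∑ T ∈ (Finset.range k).powerset,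
      (-1) ^ T.card * z ^ (k - T.card) = (z - 1) ^ k := by
    intro z
    have := Finset.sum_pow_mul_eq_add_pow (-1 : PowerSeries ℚ) z (Finset.range k)
    rw [Finset.card_range] at this
    rw [this]
    ring
  have ht : ∀ T ∈ (Finset.range k).powerset, 2 * δ * ((-1) ^ T.card *
      LaurentPolynomial.eval₂ (Int.castRingHom (PowerSeries ℚ)) expUnit
      ((parallelTwist (List.range k) List.nodup_range).delete T).jonesKauffman) =
      (δ + δ ^ 2 - 2) * ((-1) ^ T.card * (-b ^ 2) ^ (k - T.card)) +
        (δ - δ ^ 2) * ((-1) ^ T.card * (b ^ 2) ^ (k - T.card)) +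
        2 * ((-1) ^ T.card * (b ^ 6) ^ (k - T.card)) := by
    intro T hT
    have hlen : ((List.range k).filter fun x => x ∉ T).length = k - T.card := by
      rw [← List.toFinset_card_of_nodup (List.nodup_range.filter _), List.toFinset_filter]
      rw [show (List.range k).toFinset = Finset.range k by ext; simp]
      have : (Finset.range k).filter (fun x => decide (x ∉ T) = true) = Finset.range k \ T := by
        ext; simp
      rw [this, Finset.card_sdiff_of_subset (Finset.mem_powerset.1 hT), Finset.card_range]
    rw [parallelTwist_delete, mul_left_comm, eval₂_jonesKauffman_parallelTwist _ _ ha hb hδ, hlen]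
    ring
  rw [semivirtualTwistSeries, Finset.mul_sum, Finset.sum_congr rfl ht, Finset.sum_add_distrib,
    Finset.sum_add_distrib, ← Finset.mul_sum, ← Finset.mul_sum, ← Finset.mul_sum, hs, hs, hs]

theorem exists_coeff_semivirtualTwistSeries_ne_zero {n : ℕ} (hn : 2 ≤ n) (m : ℕ) :
    ∃ k, m < k ∧ PowerSeries.coeff n (semivirtualTwistSeries k) ≠ 0 := by
  by_contra! hzero
  obtain ⟨N, rfl⟩ := Nat.exists_eq_add_of_le' hn
  set a : PowerSeries ℚ := (expUnit : PowerSeries ℚ) with ha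
  set b : PowerSeries ℚ := ((expUnit⁻¹ : (PowerSeries ℚ)ˣ) : PowerSeries ℚ) with hb
  have hab : a * b = 1 := coe_expUnit_mul_inv
  set δ : PowerSeries ℚ := -a ^ 2 - b ^ 2 with hδ
  have ha0 : PowerSeries.constantCoeff a = 1 := by
    change PowerSeries.constantCoeff (PowerSeries.exp ℚ) = 1
    simp
  have hb0 : PowerSeries.constantCoeff b = 1 := by
    have := congrArg PowerSeries.constantCoeff hab
    rwa [map_mul, ha0, one_mul, map_one] at this
  have hδ0 : PowerSeries.constantCoeff δ = -2 := by
    simp only [hδ, map_sub, map_neg, map_pow, ha0, hb0]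
    norm_num
  obtain ⟨y, hy⟩ : (PowerSeries.X : PowerSeries ℚ) ∣ a - b := by
    rw [PowerSeries.X_dvd_iff, map_sub, ha0, hb0, sub_self]
  have hy0 : PowerSeries.constantCoeff y = 2 := by
    have h1 : PowerSeries.coeff 1 (a - b) = 2 := by
      change PowerSeries.coeff 1 (PowerSeries.exp ℚ - PowerSeries.evalNegHom (PowerSeries.exp ℚ)) = 2
      simp [PowerSeries.evalNegHom, PowerSeries.coeff_rescale, PowerSeries.coeff_exp]
      norm_num
    rwa [hy, ← zero_add 1, PowerSeries.coeff_succ_X_mul,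
      PowerSeries.coeff_zero_eq_constantCoeff_apply] at h1
  -- Large enough to exceed `m`, and to push the terms with `(b^2 - 1)^k₀` and `(b^6 - 1)^k₀` beyond
  -- order `n = N + 2`.
  set k₀ := m + N + 3 with hk₀
  -- The weights expand `(E + 2)^N`, with `E` the shift `k ↦ k + 1`. It multiplies `z^k₀` by `(z +
  -- 2)^N`, which for `z = -b^2 - 1` has order exactly `N`, because `1 - b^2 = b * (a - b)`.
  set H : PowerSeries ℚ := ∑ i ∈ Finset.range (N + 1),
    (2 ^ (N - i) * N.choose i : ℕ) • semivirtualTwistSeries (k₀ + i) with hH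
  have hHn : PowerSeries.coeff (N + 2) H = 0 := by
    rw [hH, map_sum]
    refine Finset.sum_eq_zero fun i _ => ?_
    rw [map_nsmul, hzero _ (by omega), smul_zero]
  have hsum : ∀ z : PowerSeries ℚ, ∑ i ∈ Finset.range (N + 1),
      ((2 ^ (N - i) * N.choose i : ℕ) : PowerSeries ℚ) * z ^ (k₀ + i) = z ^ k₀ * (z + 2) ^ N := by
    intro z
    rw [add_pow, Finset.mul_sum]
    refine Finset.sum_congr rfl fun i _ => ?_
    push_cast
    ring
  have hHδ : 2 * δ * H = (δ + δ ^ 2 - 2) * ((-b ^ 2 - 1) ^ k₀ * (-b ^ 2 - 1 + 2) ^ N) +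
      (δ - δ ^ 2) * ((b ^ 2 - 1) ^ k₀ * (b ^ 2 - 1 + 2) ^ N) +
      2 * ((b ^ 6 - 1) ^ k₀ * (b ^ 6 - 1 + 2) ^ N) := by
    rw [← hsum, ← hsum, ← hsum, hH]
    simp only [Finset.mul_sum, ← Finset.sum_add_distrib, nsmul_eq_mul]
    refine Finset.sum_congr rfl fun i _ => ?_
    rw [mul_left_comm, mul_semivirtualTwistSeries (k₀ + i) ha hb hδ]
    ring
  -- The left side is `(δ - 1) * (δ + 2)`, and `δ + 2 = -(a - b)^2` because `a * b = 1`.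
  have e1 : δ + δ ^ 2 - 2 = PowerSeries.X ^ 2 * (-y ^ 2 * (δ - 1)) := by
    linear_combination (-2 * (δ - 1)) * hab - (a - b + PowerSeries.X * y) * (δ - 1) * hy +
      (δ - 1) * hδ
  have e2 : -b ^ 2 - 1 + 2 = PowerSeries.X * (b * y) := by
    linear_combination b * hy - hab
  have e3 : b ^ 2 - 1 = PowerSeries.X * (-(b * y)) := by
    linear_combination -b * hy + hab
  have e4 : b ^ 6 - 1 = PowerSeries.X * (-(b * y) * (b ^ 4 + b ^ 2 + 1)) := by
    linear_combination (b ^ 4 + b ^ 2 + 1) * e3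
  have hpow : ∀ c : PowerSeries ℚ, (PowerSeries.X * c) ^ k₀ =
      PowerSeries.X ^ (N + 2) * (PowerSeries.X * (PowerSeries.X ^ m * c ^ k₀)) := by
    intro c
    rw [mul_pow, hk₀]
    ring
  rw [e1, e2, e3, e4, hpow, hpow, mul_pow PowerSeries.X (b * y) N] at hHδ
  have hW : 2 * δ * H = PowerSeries.X ^ (N + 2) *
      (-y ^ 2 * (δ - 1) * ((-b ^ 2 - 1) ^ k₀ * (b * y) ^ N) + PowerSeries.X *
        ((δ - δ ^ 2) * (PowerSeries.X ^ m * (-(b * y)) ^ k₀ * (b ^ 2 - 1 + 2) ^ N) +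
        2 * (PowerSeries.X ^ m * (-(b * y) * (b ^ 4 + b ^ 2 + 1)) ^ k₀ *
          (b ^ 6 - 1 + 2) ^ N))) := by
    rw [hHδ, e3, e4]
    ring
  -- As `2 * δ` has constant term -4, `H` itself is divisible by `X^(N+2)`. The quotient has
  -- constant term 0 by assumption, whereas the leading term on the right is a nonzero multiple of
  -- `(-2)^k₀ * 2^N`.
  have hX : ¬(PowerSeries.X : PowerSeries ℚ) ∣ 2 * δ := by
    rw [PowerSeries.X_dvd_iff, map_mul, hδ0, map_ofNat]
    norm_num
  obtain ⟨q, hq⟩ := PowerSeries.X_prime.pow_dvd_of_dvd_mul_left (N + 2) hX ⟨_, hW⟩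
  have hq0 : PowerSeries.constantCoeff q = 0 := by
    rw [hq, PowerSeries.coeff_X_pow_mul', if_pos le_rfl, Nat.sub_self,
      PowerSeries.coeff_zero_eq_constantCoeff_apply] at hHn
    exact hHn
  rw [hq, mul_left_comm] at hW
  have hW0 := congrArg PowerSeries.constantCoeff
    (mul_left_cancel₀ (pow_ne_zero _ PowerSeries.X_ne_zero) hW)
  simp only [map_mul, map_add, map_sub, map_neg, map_pow, map_one, hq0, hδ0, hb0, hy0,
    PowerSeries.constantCoeff_X, zero_mul, mul_zero, add_zero] at hW0
  norm_num at hW0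

theorem not_isGPVFiniteType_birmanCoeff {n : ℕ} (hn : 2 ≤ n) (m : ℕ) :
    ¬IsGPVFiniteType m (VirtualKnot.birmanCoeff n) := by
  intro h
  obtain ⟨k, hk, hne⟩ := exists_coeff_semivirtualTwistSeries_ne_zero hn m
  refine hne ?_
  rw [← gpvExtension_parallelTwist]
  refine h _ _ ?_ (by simpa using hk)
  rw [crossings_parallelTwist]
  intro x hx
  simpa using hx

theorem mainTheorem2 (n : ℕ) :
    ∃ v : VirtualKnot → ℚ,
      (∀ D : GaussDiagram, v D.toKnot = D.birmanCoeff n) ∧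
      IsKauffmanFiniteType n v ∧
      IsVirtualizationInvariant v ∧
      (2 ≤ n → ∀ m : ℕ, ¬ IsGPVFiniteType m v) := by
  refine ⟨VirtualKnot.birmanCoeff n, VirtualKnot.birmanCoeff_toKnot n,
    isKauffmanFiniteType_birmanCoeff n, fun D c _ => ?_,
    fun hn m => not_isGPVFiniteType_birmanCoeff hn m⟩
  rw [VirtualKnot.birmanCoeff_toKnot, VirtualKnot.birmanCoeff_toKnot, GaussDiagram.birmanCoeff,
    GaussDiagram.birmanCoeff, D.jonesKauffman_virtualize]
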